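/- For a profinite group $G$ let $\mathrm{Sub}(G)$ denote the set of closed subgroups of $G$ and $\mathrm{Sub}(G)/G$ the set of conjugacy classes of closed subgroups of $G$. (1) Let $G$ be an abelian profinite group. Then $\mathrm{Sub}(G)$ is countable if and only if $G$ is topologically isomorphic to $A\times\mathbb{Z}_{p_1}\times\cdots\times\mathbb{Z}_{p_r}$ for some finite (discrete) abelian group $A$, some integer $r\ge 0$ and pairwise distinct primes $p_1,\dots,p_r$. The same condition characterizes when $\mathrm{Sub}(G)/G$ is countable (for abelian $G$ the conjugation action is trivial). (2) Let $p$ be a prime, $n\ge 0$ an integer and $G=\mathrm{SL}_n(\mathbb{Z}_p)$ with its $p$-adic topology (for $n=0$ the trivial group). Then $\mathrm{Sub}(G)/G$ is countable if and only if $n\le 2$. Here "countable" means finite or countably infinite. -/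

import Mathlib

universe u

/-- Two closed subgroups `H`, `K` of a topological group `G` are identified when
`K = g H g⁻¹` for some `g : G`. -/
def closedSubgroupConjSetoid (G : Type u) [Group G] [TopologicalSpace G] :
    Setoid (ClosedSubgroup G) where
  r H K := ∃ g : G, H.toSubgroup.map (MulAut.conj g).toMonoidHom = K.toSubgroup
  iseqv := by
    refine ⟨fun H => ⟨1, ?_⟩, ?_, ?_⟩
    · ext x
      simp
    · rintro H K ⟨g, hg⟩
      refine ⟨g⁻¹, ?_⟩
      rw [← hg]
      ext x
      simp [mul_assoc]
    · rintro H K L ⟨g, hg⟩ ⟨k, hk⟩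
      refine ⟨k * g, ?_⟩
      rw [← hk, ← hg]
      ext x
      simp [mul_assoc]

/-- `Sub(G)/G`: the set of conjugacy classes of closed subgroups of `G`. -/
abbrev ClosedSubgroupClasses (G : Type u) [Group G] [TopologicalSpace G] : Type u :=
  Quotient (closedSubgroupConjSetoid G)

/-- `G` is topologically isomorphic to `A × ℤ_{p₁} × ⋯ × ℤ_{p_r}` with `A` a finite (discrete)
abelian group and `p₁, …, p_r` pairwise distinct primes (`r = 0` is allowed). The additive groups
`ℤ_{p_i}` are written multiplicatively. -/
def IsFiniteTimesDistinctPadics (G : Type u) [CommGroup G] [TopologicalSpace G] : Prop :=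
  ∃ (A : Type) (_ : CommGroup A) (_ : TopologicalSpace A) (r : ℕ) (p : Fin r → ℕ)
    (_ : ∀ i, Fact (p i).Prime),
    Finite A ∧ DiscreteTopology A ∧ Function.Injective p ∧
      Nonempty (G ≃ₜ* A × (∀ i : Fin r, Multiplicative ℤ_[p i]))

/-! Abelian case. If `Sub(G)` is countable, Baire category applied to the subgroups closure(ℤg)
makes one of them open (`exists_isOpen_closure_zmultiples`). Only finitely many primes occur in it,
since otherwise the subsets of an infinite set of primes would index distinct closed subgroups
(`finite_supportPrimes`). Hence n ↦ ng extends to a continuous map from a finite product of ℤ_q with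
open image. Dropping the factors on which it is not injective leaves an open copy of a product of
ℤ_q, and this splits off up to a finite group (`exists_finite_prod_equiv`). Conversely, ℕ is dense
in a product of ℤ_q over distinct primes, so closed subgroups of that product are ideals. A closed
subgroup of A × ∏ ℤ_q is then recovered from finitely many exponents and its image in a finite
quotient.

SL₂. Let Γ be the congruence subgroup modulo p². If H ∩ Γ = 1 then H is finite, and finite subgroups
close enough to each other are conjugate by averaging an intertwiner. Otherwise consider the
trace-zero parts of the elements of H ∩ Γ, as for a Lie algebra. In dimension three H is open. In
dimension two H is, up to conjugacy, relatively open in the upper triangular group. In dimension one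
H is, up to conjugacy, relatively open either in the upper triangular group with torsion diagonal or
in the group preserving a line ℤ_p X with det X ≠ 0 up to sign. Such an X is conjugate, up to a
scalar, to an integer matrix, so countably many ambient groups suffice. Each has countably many
subgroups containing a congruence subgroup of it. The passage from linear span to actual elements of
H is `ClosedSubgroup.exists_forall_mem_of_span`, by successive approximation.

SL_n with n ≥ 3. There is room for two independent eigenvalues, and the procyclic groups generated
by diag(1 + p², 1 + p²a, …) fall into uncountably many classes as a varies. -/

section SpecialLinear

open Matrix

/-! ### Divisibility and square roots in ℤ_p. -/

section PadicBasics

variable {p : ℕ} [Fact p.Prime]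

theorem PadicInt.natCast_self_ne_zero : (p : ℤ_[p]) ≠ 0 :=
  Nat.cast_ne_zero.mpr (Fact.out : p.Prime).ne_zero

theorem PadicInt.eq_zero_of_forall_pow_dvd {x : ℤ_[p]} (h : ∀ k : ℕ, (p : ℤ_[p]) ^ k ∣ x) :
    x = 0 := by
  by_contra hx
  have := h (x.valuation + 1)
  rw [← Ideal.mem_span_singleton, PadicInt.mem_span_pow_iff_le_valuation x hx] at this
  omega

theorem PadicInt.exists_dvd_pow {x : ℤ_[p]} (hx : x ≠ 0) : ∃ k : ℕ, x ∣ (p : ℤ_[p]) ^ k := by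
  refine ⟨x.valuation, ?_⟩
  conv_lhs => rw [PadicInt.unitCoeff_spec hx]
  exact (Units.mul_left_dvd).mpr dvd_rfl

theorem PadicInt.isUnit_one_add_mul (x : ℤ_[p]) : IsUnit (1 + (p : ℤ_[p]) * x) := by
  rw [PadicInt.isUnit_iff]
  have h : ‖(p : ℤ_[p]) * x‖ < 1 := by
    rw [norm_mul]
    calc ‖(p : ℤ_[p])‖ * ‖x‖ ≤ ‖(p : ℤ_[p])‖ * 1 := by gcongr; exact PadicInt.norm_le_one x
      _ < 1 := by rw [mul_one]; simpa using inv_lt_one_of_one_lt₀ (by exact_mod_cast (Fact.out : p.Prime).one_lt)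
  rw [add_comm, PadicInt.norm_add_eq_max_of_ne (by rw [norm_one]; exact h.ne), norm_one,
    max_eq_right h.le]

/-- This lets p = 2 be treated together with the odd primes: 2 has valuation at most one, and
congruences modulo p² still see it. -/
theorem PadicInt.not_sq_dvd_two : ¬ (p : ℤ_[p]) ^ 2 ∣ 2 := by
  intro h
  have h3 : ((p : ℤ) ^ 2) ∣ 2 := (PadicInt.pow_p_dvd_int_iff 2 2).mp (by exact_mod_cast h)
  have h4 := Int.le_of_dvd (by norm_num) h3
  have : (2 : ℤ) ≤ p := by exact_mod_cast (Fact.out : p.Prime).two_le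
  nlinarith

/-- A unit `u ≡ 1` modulo `p ^ 3` is a square. -/
theorem PadicInt.exists_sq_eq {u : ℤ_[p]} (hu : (p : ℤ_[p]) ^ 3 ∣ u - 1) : ∃ w, w ^ 2 = u := by
  -- Hensel's lemma for X² - u at 1 needs |1 - u| < |2|². Since |2| ≥ p⁻¹ for every p, the exponent
  -- 3 suffices.
  have hn : ‖Polynomial.aeval (1 : ℤ_[p]) (Polynomial.X ^ 2 - Polynomial.C u : Polynomial ℤ_[p])‖ <
      ‖Polynomial.aeval (1 : ℤ_[p])
        (Polynomial.derivative (Polynomial.X ^ 2 - Polynomial.C u : Polynomial ℤ_[p]))‖ ^ 2 := by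
    have h1 : ‖1 - u‖ ≤ (p : ℝ) ^ (-(3 : ℕ) : ℤ) := by
      rw [PadicInt.norm_le_pow_iff_mem_span_pow, Ideal.mem_span_singleton]
      rw [← neg_sub]; exact (dvd_neg).mpr hu
    have hp : (1 : ℝ) < p := by exact_mod_cast (Fact.out : p.Prime).one_lt
    have h2 : (p : ℝ) ^ (-(1 : ℕ) : ℤ) ≤ ‖(2 : ℤ_[p])‖ := by
      by_contra hlt
      push Not at hlt
      apply PadicInt.not_sq_dvd_two (p := p)
      rw [← Ideal.mem_span_singleton, ← PadicInt.norm_le_pow_iff_mem_span_pow]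
      have := (PadicInt.norm_lt_pow_iff_norm_le_pow_sub_one (2 : ℤ_[p]) (-(1 : ℕ) : ℤ)).mp hlt
      simpa using this
    simp only [map_sub, map_pow, Polynomial.aeval_X, Polynomial.aeval_C, one_pow,
      Polynomial.derivative_X_pow, Polynomial.derivative_C, sub_zero,
      map_mul]
    simp only [Algebra.algebraMap_self, RingHom.id_apply, Nat.cast_ofNat, map_ofNat,
      mul_one]
    calc ‖1 - u‖ ≤ (p : ℝ) ^ (-(3 : ℕ) : ℤ) := h1
      _ < ((p : ℝ) ^ (-(1 : ℕ) : ℤ)) ^ 2 := by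
        rw [← zpow_natCast, ← _root_.zpow_mul]
        exact zpow_lt_zpow_right₀ hp (by norm_num)
      _ ≤ _ := by gcongr
  obtain ⟨z, hz, -⟩ := hensels_lemma hn
  refine ⟨z, ?_⟩
  simpa [sub_eq_zero] using hz

end PadicBasics

/-! ### Congruence subgroups of SL_n(ℤ_p). -/

section Congruence

variable {p : ℕ} [Fact p.Prime] {n : ℕ}

/-- The kernel of `SL_n(ℤ_p) → SL_n(ℤ / p ^ m)`. -/
noncomputable def padicCongruenceSubgroup (n p : ℕ) [Fact p.Prime] (m : ℕ) :
    Subgroup (SpecialLinearGroup (Fin n) ℤ_[p]) :=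
  (Matrix.SpecialLinearGroup.map (n := Fin n) (PadicInt.toZModPow (p := p) m)).ker

instance (m : ℕ) : (padicCongruenceSubgroup n p m).Normal := by
  unfold padicCongruenceSubgroup; infer_instance

theorem PadicInt.toZModPow_eq_iff {m : ℕ} {x y : ℤ_[p]} :
    PadicInt.toZModPow m x = PadicInt.toZModPow m y ↔ (p : ℤ_[p]) ^ m ∣ x - y := by
  rw [← sub_eq_zero, ← map_sub, ← RingHom.mem_ker, PadicInt.ker_toZModPow,
    Ideal.mem_span_singleton]

theorem mem_padicCongruenceSubgroup {m : ℕ} {g : SpecialLinearGroup (Fin n) ℤ_[p]} :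
    g ∈ padicCongruenceSubgroup n p m ↔
      ∃ w : Matrix (Fin n) (Fin n) ℤ_[p], (g : Matrix (Fin n) (Fin n) ℤ_[p]) =
        1 + (p : ℤ_[p]) ^ m • w := by
  have h1 : g ∈ padicCongruenceSubgroup n p m ↔
      ∀ i j, (p : ℤ_[p]) ^ m ∣ (g : Matrix (Fin n) (Fin n) ℤ_[p]) i j -
        (1 : Matrix (Fin n) (Fin n) ℤ_[p]) i j := by
    rw [padicCongruenceSubgroup, MonoidHom.mem_ker, Matrix.SpecialLinearGroup.ext_iff]
    refine forall_congr' fun i => forall_congr' fun j => ?_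
    rw [← PadicInt.toZModPow_eq_iff]
    have : (1 : Matrix (Fin n) (Fin n) (ZMod (p ^ m))) i j =
      PadicInt.toZModPow m ((1 : Matrix (Fin n) (Fin n) ℤ_[p]) i j) := by
      by_cases hij : i = j <;> simp [Matrix.one_apply, hij]
    simp [this]
  rw [h1]
  constructor
  · intro h
    choose w hw using h
    refine ⟨Matrix.of w, ?_⟩
    ext i j
    simp [← hw]
  · rintro ⟨w, hw⟩ i j
    rw [hw]
    simp

theorem padicCongruenceSubgroup_antitone : Antitone (padicCongruenceSubgroup n p) := by
  intro k m hkm g hg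
  rw [mem_padicCongruenceSubgroup] at hg ⊢
  obtain ⟨w, hw⟩ := hg
  refine ⟨(p : ℤ_[p]) ^ (m - k) • w, ?_⟩
  rw [hw, smul_smul, ← pow_add, Nat.add_sub_cancel' hkm]

theorem inv_mul_mem_padicCongruenceSubgroup {m : ℕ} {g h : SpecialLinearGroup (Fin n) ℤ_[p]}
    {w : Matrix (Fin n) (Fin n) ℤ_[p]}
    (hw : (g : Matrix (Fin n) (Fin n) ℤ_[p]) = h + (p : ℤ_[p]) ^ m • w) :
    h⁻¹ * g ∈ padicCongruenceSubgroup n p m := by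
  rw [mem_padicCongruenceSubgroup]
  refine ⟨(h⁻¹ : SpecialLinearGroup (Fin n) ℤ_[p]) * w, ?_⟩
  rw [Matrix.SpecialLinearGroup.coe_mul, hw, mul_add, ← Matrix.SpecialLinearGroup.coe_mul, inv_mul_cancel,
    Matrix.SpecialLinearGroup.coe_one, Matrix.mul_smul]

/-- The chosen elements h of H agree with z modulo higher and higher powers of p, so they converge
to z entrywise. -/
theorem ClosedSubgroup.mem_of_forall_exists (H : ClosedSubgroup (SpecialLinearGroup (Fin n) ℤ_[p]))
    {z : SpecialLinearGroup (Fin n) ℤ_[p]}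
    (hz : ∀ k, ∃ h ∈ H.toSubgroup, h⁻¹ * z ∈ padicCongruenceSubgroup n p k) :
    z ∈ H.toSubgroup := by
  choose h hH hk using hz
  refine H.isClosed'.mem_of_tendsto (b := Filter.atTop) (f := h) ?_ (Filter.Eventually.of_forall hH)
  have ind : Topology.IsInducing (fun g : SpecialLinearGroup (Fin n) ℤ_[p] =>
      (g : Matrix (Fin n) (Fin n) ℤ_[p])) := ⟨rfl⟩
  refine ind.tendsto_nhds_iff.mpr ?_
  refine tendsto_pi_nhds.mpr fun i => tendsto_pi_nhds.mpr fun j => ?_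
  rw [tendsto_iff_norm_sub_tendsto_zero]
  have hp : (1 : ℝ) < p := by exact_mod_cast (Fact.out : p.Prime).one_lt
  refine squeeze_zero (fun _ => norm_nonneg _) (g := fun k : ℕ => ((p : ℝ)⁻¹) ^ k) (fun k => ?_)
    (tendsto_pow_atTop_nhds_zero_of_lt_one (by positivity) (inv_lt_one_of_one_lt₀ hp))
  obtain ⟨w, hw⟩ := mem_padicCongruenceSubgroup.mp (hk k)
  have hz : (z : Matrix (Fin n) (Fin n) ℤ_[p]) = h k + (p : ℤ_[p]) ^ k • (h k * w) := by
    rw [← Matrix.mul_smul, ← mul_one_add, ← hw, ← Matrix.SpecialLinearGroup.coe_mul, mul_inv_cancel_left]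
  have h3 : ‖((h k : Matrix (Fin n) (Fin n) ℤ_[p]) i j - (z : Matrix (Fin n) (Fin n) ℤ_[p]) i j)‖ ≤
      (p : ℝ) ^ (-(k : ℤ)) := by
    rw [PadicInt.norm_le_pow_iff_mem_span_pow, Ideal.mem_span_singleton, hz]
    simp
  simpa using h3

end Congruence

/-! ### From the linear span of H to the elements of H in SL₂. -/

section TwoByTwo

variable {p : ℕ} [Fact p.Prime]

local notation "M₂" => Matrix (Fin 2) (Fin 2) ℤ_[p]
local notation "G₂" => SpecialLinearGroup (Fin 2) ℤ_[p]

theorem Matrix.sq_eq_trace_smul_sub_det_fin_two {R : Type*} [CommRing R]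
    (y : Matrix (Fin 2) (Fin 2) R) : y * y = y.trace • y - y.det • 1 := by
  ext i j
  fin_cases i <;> fin_cases j <;>
    simp [Matrix.mul_apply, Fin.sum_univ_two, Matrix.trace, Matrix.det_fin_two] <;> ring

/-- By Cayley–Hamilton every power of 1 + ry is a combination of 1 and y; all terms of the expansion
beyond the linear one carry a factor r². -/
theorem Matrix.one_add_smul_pow_fin_two {R : Type*} [CommRing R] (r : R)
    (y : Matrix (Fin 2) (Fin 2) R) (n : ℕ) :
    ∃ α β : R, (1 + r • y) ^ n = (1 + r ^ 2 * α) • (1 : Matrix (Fin 2) (Fin 2) R) +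
      (n * r + r ^ 2 * β) • y := by
  induction n with
  | zero => exact ⟨0, 0, by simp⟩
  | succ n ih =>
    obtain ⟨α, β, h⟩ := ih
    refine ⟨α - (n + r * β) * y.det, β + r * α + (n + r * β) * y.trace, ?_⟩
    rw [pow_succ, h, mul_add, mul_one, Matrix.mul_smul, add_mul, Matrix.smul_mul, one_mul,
      Matrix.smul_mul, Matrix.sq_eq_trace_smul_sub_det_fin_two y]
    push_cast
    module

/-- Iterated `p`-th powers of an element `x ≡ 1` modulo `p ^ 2`. -/
theorem exists_pow_prime_pow_eq (x : G₂) (hx : x ∈ padicCongruenceSubgroup 2 p 2) (j : ℕ) :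
    x ^ p ^ j ∈ padicCongruenceSubgroup 2 p (j + 2) ∧
      ∃ α μ : ℤ_[p], IsUnit μ ∧ ((x ^ p ^ j : G₂) : M₂) = α • 1 + (p ^ j * μ) • (x : M₂) := by
  induction j with
  | zero => exact ⟨by simpa using hx, 0, 1, isUnit_one, by simp⟩
  | succ j ih =>
    obtain ⟨h1, α, μ, hμ, h2⟩ := ih
    obtain ⟨y, hy⟩ := mem_padicCongruenceSubgroup.mp h1
    obtain ⟨α', β', h3⟩ := Matrix.one_add_smul_pow_fin_two ((p : ℤ_[p]) ^ (j + 2)) y p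
    have h4 : ((x ^ p ^ (j + 1) : G₂) : M₂) = (((x ^ p ^ j : G₂) : M₂)) ^ p := by
      rw [pow_succ, pow_mul, Matrix.SpecialLinearGroup.coe_pow]
    have h5 : (p : ℤ_[p]) ^ (j + 2) • y = ((x ^ p ^ j : G₂) : M₂) - 1 := by rw [hy]; abel
    refine ⟨?_, ?_⟩
    · rw [mem_padicCongruenceSubgroup]
      refine ⟨y + (p : ℤ_[p]) ^ (j + 1) • (α' • 1 + β' • y), ?_⟩
      rw [h4, hy, h3]
      module
    -- The coefficient of y is p · p^(j+2) times a principal unit, so one more p-th power multiplies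
    -- the non-scalar part by p times a unit.
    · have h6 : (p * (p : ℤ_[p]) ^ (j + 2) + ((p : ℤ_[p]) ^ (j + 2)) ^ 2 * β') • y =
          (p * (1 + p * ((p : ℤ_[p]) ^ j * β'))) • ((p : ℤ_[p]) ^ (j + 2) • y) := by module
      refine ⟨(1 + ((p : ℤ_[p]) ^ (j + 2)) ^ 2 * α') -
        p * (1 + p * ((p : ℤ_[p]) ^ j * β')) * (1 - α),
        (1 + p * ((p : ℤ_[p]) ^ j * β')) * μ, (PadicInt.isUnit_one_add_mul _).mul hμ, ?_⟩
      rw [h4, hy, h3, h6, h5, h2]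
      module

/-- The matrices which occur, up to scalars and to second order, as the first order terms of
elements of `H` congruent to `1` modulo `p ^ (j + 2)`. -/
def leadingTerms (H : Subgroup G₂) (j : ℕ) : Submodule ℤ_[p] M₂ where
  carrier := {w | ∃ h ∈ H, h ∈ padicCongruenceSubgroup 2 p (j + 2) ∧ ∃ (σ : ℤ_[p]) (t : M₂),
    (h : M₂) = σ • 1 + (p : ℤ_[p]) ^ j • w + (p : ℤ_[p]) ^ (2 * j + 4) • t}
  zero_mem' := ⟨1, one_mem _, one_mem _, 1, 0, by simp⟩
  add_mem' := by
    rintro w₁ w₂ ⟨h₁, hH₁, hΓ₁, σ₁, t₁, e₁⟩ ⟨h₂, hH₂, hΓ₂, σ₂, t₂, e₂⟩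
    refine ⟨h₁ * h₂, mul_mem hH₁ hH₂, mul_mem hΓ₁ hΓ₂, ?_⟩
    obtain ⟨y₁, hy₁⟩ := mem_padicCongruenceSubgroup.mp hΓ₁
    obtain ⟨y₂, hy₂⟩ := mem_padicCongruenceSubgroup.mp hΓ₂
    -- Close to 1, multiplication is addition up to the product of the two deviations, which has
    -- order p^(2j+4) and goes into t.
    have h : ((h₁ * h₂ : G₂) : M₂) = h₁ + h₂ - 1 + (p : ℤ_[p]) ^ (2 * j + 4) • (y₁ * y₂) := by
      simp only [Matrix.SpecialLinearGroup.coe_mul, hy₁, hy₂, add_mul, mul_add, Matrix.smul_mul,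
        Matrix.mul_smul, one_mul, mul_one]
      module
    refine ⟨σ₁ + σ₂ - 1, t₁ + t₂ + y₁ * y₂, ?_⟩
    rw [h, e₁, e₂]
    module
  smul_mem' := by
    rintro a w ⟨h, hH, hΓ, σ, t, e⟩
    -- Scaling by a p-adic number a is imitated by an ordinary power h ^ m with m ≡ a modulo
    -- p^(j+4); the discrepancy p^j · p^(j+4) b w is again of order p^(2j+4).
    obtain ⟨m, b, hb⟩ : ∃ (m : ℕ) (b : ℤ_[p]), a = m + (p : ℤ_[p]) ^ (j + 4) * b := by
      obtain ⟨b, hb⟩ := Ideal.mem_span_singleton.mp (PadicInt.appr_spec (j + 4) a)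
      exact ⟨_, b, by rw [← hb]; ring⟩
    obtain ⟨y, hy⟩ := mem_padicCongruenceSubgroup.mp hΓ
    obtain ⟨α, β, h3⟩ := Matrix.one_add_smul_pow_fin_two ((p : ℤ_[p]) ^ (j + 2)) y m
    have h5 : (p : ℤ_[p]) ^ (j + 2) • y = (h : M₂) - 1 := by rw [hy]; abel
    refine ⟨h ^ m, pow_mem hH m, pow_mem hΓ m, ?_⟩
    have h6 : (m * (p : ℤ_[p]) ^ (j + 2) + ((p : ℤ_[p]) ^ (j + 2)) ^ 2 * β) • y =
        (m : ℤ_[p]) • ((p : ℤ_[p]) ^ (j + 2) • y) + (p : ℤ_[p]) ^ (2 * j + 4) • (β • y) := by module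
    refine ⟨1 + m * (σ - 1), α • 1 + β • y + (m : ℤ_[p]) • t - b • w, ?_⟩
    rw [Matrix.SpecialLinearGroup.coe_pow, hy, h3, h6, h5, e, hb]
    module

/-- The power x^(p^j) is a scalar plus p^j times a unit multiple of x. Thus the modules of all
levels j contain one fixed lattice, which bounds the denominators uniformly in j. -/
theorem coe_mem_leadingTerms {H : Subgroup G₂} {x : G₂} (hx : x ∈ H)
    (hΓ : x ∈ padicCongruenceSubgroup 2 p 2) (j : ℕ) : (x : M₂) ∈ leadingTerms H j := by
  obtain ⟨h1, α, μ, hμ, h2⟩ := exists_pow_prime_pow_eq x hΓ j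
  obtain ⟨u, rfl⟩ := hμ
  have : (u : ℤ_[p]) • (x : M₂) ∈ leadingTerms H j :=
    ⟨_, pow_mem hx _, h1, α, 0, by rw [h2]; module⟩
  have := (leadingTerms H j).smul_mem ((u⁻¹ : ℤ_[p]ˣ) : ℤ_[p]) this
  rwa [smul_smul, Units.inv_mul, one_smul] at this

theorem PadicInt.pow_dvd_of_pow_succ_dvd_mul {k : ℕ} {a b : ℤ_[p]} (ha : ¬ (p : ℤ_[p]) ^ 2 ∣ a)
    (h : (p : ℤ_[p]) ^ (k + 1) ∣ a * b) : (p : ℤ_[p]) ^ k ∣ b := by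
  have hp : Prime (p : ℤ_[p]) := PadicInt.prime_p
  by_cases hpa : (p : ℤ_[p]) ∣ a
  · obtain ⟨a', rfl⟩ := hpa
    have ha' : ¬ (p : ℤ_[p]) ∣ a' := fun h' => ha (by rw [sq]; exact mul_dvd_mul_left _ h')
    rw [pow_succ', mul_assoc] at h
    exact hp.pow_dvd_of_dvd_mul_left k ha' ((mul_dvd_mul_iff_left hp.ne_zero).mp h)
  · exact (pow_dvd_pow _ (Nat.le_succ k)).trans (hp.pow_dvd_of_dvd_mul_left _ hpa h)

/-- If `det h = det z = 1` and `h - z` is nearly scalar then `h` is close to `z`. -/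
theorem exists_eq_add_smul_of_eq_scalar_add {k : ℕ} {h z : G₂}
    (hh : h ∈ padicCongruenceSubgroup 2 p 2) (hz : z ∈ padicCongruenceSubgroup 2 p 2)
    {σ : ℤ_[p]} {t : M₂} (e : (h : M₂) = z + σ • 1 + (p : ℤ_[p]) ^ (k + 2) • t) :
    ∃ s : M₂, (h : M₂) = z + (p : ℤ_[p]) ^ (k + 1) • s := by
  obtain ⟨y, hy⟩ := mem_padicCongruenceSubgroup.mp hh
  obtain ⟨w, hw⟩ := mem_padicCongruenceSubgroup.mp hz
  have hdet := Matrix.SpecialLinearGroup.det_coe h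
  have hdetz := Matrix.SpecialLinearGroup.det_coe z
  have hσ : σ = (p : ℤ_[p]) ^ 2 * (y 0 0 - w 0 0 - (p : ℤ_[p]) ^ k * t 0 0) := by
    have := congrFun (congrFun e 0) 0
    rw [hy, hw] at this
    simp at this
    linear_combination -this
  rw [e, Matrix.det_fin_two] at hdet
  rw [hw, Matrix.det_fin_two] at hdetz
  rw [hw] at hdet
  simp at hdet hdetz
  set q := (p : ℤ_[p])
  -- Comparing determinants gives σ (tr z + σ) ≡ 0 modulo p^(k+2). As tr z + σ ≡ 2 modulo p² has
  -- valuation at most one, only one power of p is lost.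
  obtain ⟨s, hs⟩ : q ^ (k + 1) ∣ σ := by
    refine PadicInt.pow_dvd_of_pow_succ_dvd_mul (a := 2 + q ^ 2 * (w 0 0 + w 1 1) + σ)
      (fun hd => PadicInt.not_sq_dvd_two (p := p) ?_) ?_
    · rw [hσ, add_assoc, ← mul_add] at hd
      exact (dvd_add_left (dvd_mul_right _ _)).mp hd
    · refine ⟨-((1 + q ^ 2 * w 0 0 + σ) * t 1 1 + (1 + q ^ 2 * w 1 1 + σ) * t 0 0 -
        q ^ 2 * w 0 1 * t 1 0 - q ^ 2 * w 1 0 * t 0 1 +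
        q ^ (k + 2) * (t 0 0 * t 1 1 - t 0 1 * t 1 0)), ?_⟩
      linear_combination hdet - hdetz
  refine ⟨s • 1 + q • t, ?_⟩
  rw [e, hs]
  module

/-- A closed subgroup whose elements close to `1` span, up to bounded denominators, a saturated
algebra `A` contains all the elements of `A` of determinant one which are close to `1`. -/
theorem ClosedSubgroup.exists_forall_mem_of_span (H : ClosedSubgroup G₂) (A : Subalgebra ℤ_[p] M₂)
    (hA : ∀ w : M₂, (p : ℤ_[p]) • w ∈ A → w ∈ A)
    (hHA : ∀ x ∈ H.toSubgroup, x ∈ padicCongruenceSubgroup 2 p 2 → (x : M₂) ∈ A)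
    {d : ℤ_[p]} (hd : d ≠ 0)
    (hspan : ∀ w ∈ A, d • w ∈ Submodule.span ℤ_[p]
      {y : M₂ | ∃ x ∈ H.toSubgroup, x ∈ padicCongruenceSubgroup 2 p 2 ∧ (x : M₂) = y}) :
    ∃ m, 2 ≤ m ∧ ∀ z ∈ padicCongruenceSubgroup 2 p m, (z : M₂) ∈ A → z ∈ H.toSubgroup := by
  obtain ⟨c, d', hc⟩ := PadicInt.exists_dvd_pow hd
  have hA' : ∀ (k : ℕ) (w : M₂), (p : ℤ_[p]) ^ k • w ∈ A → w ∈ A := by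
    intro k
    induction k with
    | zero => intro w hw; simpa using hw
    | succ k ih => intro w hw; exact ih _ (hA _ (by rwa [smul_smul, ← pow_succ']))
  have hlead : ∀ j, ∀ w ∈ A, (p : ℤ_[p]) ^ c • w ∈ leadingTerms H.toSubgroup j := by
    intro j w hw
    rw [hc, mul_comm, mul_smul]
    refine Submodule.smul_mem _ _ ?_
    refine (Submodule.span_le.mpr ?_) (hspan w hw)
    rintro _ ⟨x, hx, hΓ, rfl⟩
    exact coe_mem_leadingTerms hx hΓ j
  -- One correction step. With k = j + c, the level j supplies h in H equal to a scalar plus p^k w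
  -- up to order 2j + 4, and k ≥ 2c + 2 ensures 2j + 4 ≥ k + 2. The determinant condition then
  -- removes the scalar.
  have step : ∀ k, 2 * c + 2 ≤ k → ∀ z ∈ padicCongruenceSubgroup 2 p k, (z : M₂) ∈ A →
      ∃ h ∈ H.toSubgroup, h ∈ padicCongruenceSubgroup 2 p 2 ∧
        h⁻¹ * z ∈ padicCongruenceSubgroup 2 p (k + 1) := by
    intro k hk z hz hzA
    obtain ⟨w, hw⟩ := mem_padicCongruenceSubgroup.mp hz
    have hwA : w ∈ A := by
      refine hA' k w ?_
      rw [show (p : ℤ_[p]) ^ k • w = (z : M₂) - 1 by rw [hw]; abel]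
      exact sub_mem hzA (one_mem _)
    obtain ⟨j, rfl⟩ : ∃ j, k = j + c := ⟨k - c, by omega⟩
    obtain ⟨h, hH, hΓ, σ, t, e⟩ := hlead j w hwA
    have h2 : h ∈ padicCongruenceSubgroup 2 p 2 := padicCongruenceSubgroup_antitone (by omega) hΓ
    obtain ⟨i, hi⟩ : ∃ i, 2 * j + 4 = (j + c + 2) + i := ⟨j + 2 - c, by omega⟩
    obtain ⟨s, hs⟩ := exists_eq_add_smul_of_eq_scalar_add (k := j + c) (σ := σ - 1)
      (t := (p : ℤ_[p]) ^ i • t) h2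
      (padicCongruenceSubgroup_antitone (by omega) hz) (by
        rw [e, hw, hi]
        module)
    refine ⟨h, hH, h2, inv_mul_mem_padicCongruenceSubgroup (w := -s) ?_⟩
    rw [hs]; module
  -- In SL₂ the inverse is the trace minus the matrix, so the remainder h⁻¹z stays in A and the
  -- correction can be repeated.
  have hinv : ∀ h : G₂, (h : M₂) ∈ A → ((h⁻¹ : G₂) : M₂) ∈ A := by
    intro h hh
    have : ((h⁻¹ : G₂) : M₂) = (h : M₂).trace • 1 - (h : M₂) := by
      rw [Matrix.SpecialLinearGroup.coe_inv]
      ext i j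
      fin_cases i <;> fin_cases j <;> simp [Matrix.adjugate_fin_two, Matrix.trace]
    rw [this]
    exact sub_mem (A.smul_mem (one_mem _) _) hh
  refine ⟨2 * c + 2, by omega, fun z hz hzA => H.mem_of_forall_exists fun k => ?_⟩
  suffices h : ∀ i, ∃ h ∈ H.toSubgroup, h ∈ padicCongruenceSubgroup 2 p 2 ∧
      h⁻¹ * z ∈ padicCongruenceSubgroup 2 p (2 * c + 2 + i) by
    obtain ⟨h, hH, -, hk⟩ := h k
    exact ⟨h, hH, padicCongruenceSubgroup_antitone (by omega) hk⟩
  intro i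
  induction i with
  | zero => exact ⟨1, one_mem _, one_mem _, by simpa using hz⟩
  | succ i ih =>
    obtain ⟨h, hH, h2, hi⟩ := ih
    obtain ⟨h', hH', h2', hi'⟩ := step _ (by omega) _ hi (by
      rw [Matrix.SpecialLinearGroup.coe_mul]
      exact mul_mem (hinv h (hHA h hH h2)) hzA)
    refine ⟨h * h', mul_mem hH hH', mul_mem h2 h2', ?_⟩
    rw [_root_.mul_inv_rev, mul_assoc]
    exact hi'

end TwoByTwo

/-! ### Powers of principal units. -/

section PrincipalUnits

variable {p : ℕ} [Fact p.Prime]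

theorem exists_one_add_mul_pow_eq {R : Type*} [CommRing R] (r y : R) (n : ℕ) :
    ∃ t, (1 + r * y) ^ n = 1 + r * (n * y + r * t) := by
  induction n with
  | zero => exact ⟨0, by simp⟩
  | succ n ih =>
    obtain ⟨t, ht⟩ := ih
    refine ⟨t + y * (n * y + r * t), ?_⟩
    rw [pow_succ, ht]
    push_cast
    ring

/-- The valuation of `a ^ k - 1` for a principal unit `a ≠ 1`. -/
theorem PadicInt.exists_forall_pow_dvd_of_dvd_pow_sub_one {a : ℤ_[p]} (ha : (p : ℤ_[p]) ^ 2 ∣ a - 1)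
    (ha1 : a ≠ 1) : ∃ r : ℕ, ∀ j k : ℕ, (p : ℤ_[p]) ^ (r + j) ∣ a ^ k - 1 → p ^ j ∣ k := by
  have hp : Prime (p : ℤ_[p]) := PadicInt.prime_p
  have hne : a - 1 ≠ 0 := sub_ne_zero.mpr ha1
  set r := (a - 1).valuation with hr
  set y : ℤ_[p] := (PadicInt.unitCoeff hne : ℤ_[p]) with hy
  have hay : a = 1 + (p : ℤ_[p]) ^ r * y := by
    rw [mul_comm, ← PadicInt.unitCoeff_spec hne]; ring
  have hpy : ¬ (p : ℤ_[p]) ∣ y := fun h => hp.not_isUnit (isUnit_of_dvd_unit h (Units.isUnit _))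
  have hr2 : 2 ≤ r := by
    rw [← PadicInt.mem_span_pow_iff_le_valuation _ hne, Ideal.mem_span_singleton]; exact ha
  -- Each p-th power raises the valuation of a - 1 by exactly one: as r ≥ 2, the error term is
  -- divisible by one more p than the main term.
  have key : ∀ i, ∃ y' : ℤ_[p], ¬ (p : ℤ_[p]) ∣ y' ∧ a ^ p ^ i = 1 + (p : ℤ_[p]) ^ (r + i) * y' := by
    intro i
    induction i with
    | zero => exact ⟨y, hpy, by simpa using hay⟩
    | succ i ih =>
      obtain ⟨y', hy', h⟩ := ih
      obtain ⟨t, ht⟩ := exists_one_add_mul_pow_eq ((p : ℤ_[p]) ^ (r + i)) y' p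
      obtain ⟨s, hs⟩ : ∃ s, r + i = 2 + s := ⟨r + i - 2, by omega⟩
      refine ⟨y' + p * ((p : ℤ_[p]) ^ s * t), fun hd => hy' ((dvd_add_left
        (dvd_mul_right _ _)).mp hd), ?_⟩
      rw [pow_succ p i, pow_mul, h, ht, ← add_assoc r i 1, hs]
      ring
  refine ⟨r, fun j k hk => ?_⟩
  rcases Nat.eq_zero_or_pos k with rfl | hk0
  · exact dvd_zero _
  obtain ⟨i, k', hk', rfl⟩ := Nat.exists_eq_pow_mul_and_not_dvd hk0.ne' p
    (Fact.out : p.Prime).ne_one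
  obtain ⟨y', hy', h⟩ := key i
  obtain ⟨t, ht⟩ := exists_one_add_mul_pow_eq ((p : ℤ_[p]) ^ (r + i)) y' k'
  rw [pow_mul, h, ht, add_sub_cancel_left] at hk
  by_contra hlt
  have hij : i < j := by
    by_contra hji
    exact hlt ((pow_dvd_pow p (not_lt.mp hji)).trans (dvd_mul_right _ _))
  obtain ⟨s, hs⟩ : ∃ s, r + i = 1 + s := ⟨r + i - 1, by omega⟩
  have h1 : (p : ℤ_[p]) ^ (r + i) * p ∣ (p : ℤ_[p]) ^ (r + i) * (k' * y' + (p : ℤ_[p]) ^ (r + i) * t) :=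
    (by rw [← pow_succ]; exact pow_dvd_pow _ (by omega) : _ ∣ (p : ℤ_[p]) ^ (r + j)).trans hk
  have h2 := (mul_dvd_mul_iff_left (pow_ne_zero _ hp.ne_zero)).mp h1
  have h3 : (p : ℤ_[p]) ∣ k' * y' := by
    refine (dvd_add_left ?_).mp h2
    rw [hs, pow_add, pow_one, mul_assoc]
    exact dvd_mul_right _ _
  rcases hp.dvd_or_dvd h3 with h4 | h4
  · apply hk'
    have := (PadicInt.pow_p_dvd_int_iff (p := p) 1 (k' : ℤ)).mp (by simpa using h4)
    exact_mod_cast (by simpa using this : (p : ℤ) ∣ k')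
  · exact hy' h4

/-- If a ≠ 1, every power of p would divide k. The congruence modulo p² excludes a = -1 when p = 2.
-/
theorem PadicInt.eq_one_of_pow_eq_one {a : ℤ_[p]} (ha : (p : ℤ_[p]) ^ 2 ∣ a - 1) {k : ℕ}
    (hk : 0 < k) (h : a ^ k = 1) : a = 1 := by
  by_contra ha1
  obtain ⟨r, hr⟩ := PadicInt.exists_forall_pow_dvd_of_dvd_pow_sub_one ha ha1
  have := Nat.le_of_dvd hk (hr k k (by simp [h]))
  exact absurd this (not_le.mpr (Nat.lt_pow_self (Fact.out : p.Prime).one_lt))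

end PrincipalUnits

/-! ### Counting conjugacy classes by countable data. -/

section ConjugacyClasses

variable {G : Type*} [Group G] [TopologicalSpace G]

/-- The conjugate `g H g⁻¹` of a closed subgroup. -/
def ClosedSubgroup.conj [IsTopologicalGroup G] (g : G) (H : ClosedSubgroup G) :
    ClosedSubgroup G where
  toSubgroup := H.toSubgroup.map (MulAut.conj g).toMonoidHom
  isClosed' := by
    have : (H.toSubgroup.map (MulAut.conj g).toMonoidHom).carrier =
        (fun x => g⁻¹ * x * g) ⁻¹' H.toSubgroup.carrier := by
      ext x
      constructor
      · rintro ⟨y, hy, rfl⟩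
        simpa [mul_assoc] using hy
      · intro hx
        exact ⟨g⁻¹ * x * g, hx, by simp [mul_assoc]⟩
    rw [this]
    exact H.isClosed'.preimage (by fun_prop)

theorem ClosedSubgroup.mem_conj [IsTopologicalGroup G] {g x : G} {H : ClosedSubgroup G} :
    x ∈ (H.conj g).toSubgroup ↔ g⁻¹ * x * g ∈ H.toSubgroup := by
  constructor
  · rintro ⟨y, hy, rfl⟩
    simpa [mul_assoc] using hy
  · intro hx
    exact ⟨g⁻¹ * x * g, hx, by simp [mul_assoc]⟩

theorem ClosedSubgroup.mk_conj [IsTopologicalGroup G] (g : G) (H : ClosedSubgroup G) :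
    (⟦H.conj g⟧ : ClosedSubgroupClasses G) = ⟦H⟧ :=
  (Quotient.sound (⟨g, rfl⟩ : (closedSubgroupConjSetoid G) H (H.conj g))).symm

/-- Counting by invariants attached non-canonically: an element may carry several d, so a relation
replaces an invariant function. -/
theorem Set.Countable.image_of_relation {X Y D : Type*} [Countable D] (f : X → Y) (S : Set X)
    (Φ : X → D → Prop) (h1 : ∀ x ∈ S, ∃ d, Φ x d)
    (h2 : ∀ x ∈ S, ∀ y ∈ S, ∀ d, Φ x d → Φ y d → f x = f y) : (f '' S).Countable := by
  have : f '' S ⊆ ⋃ d, f '' {x ∈ S | Φ x d} := by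
    rintro _ ⟨x, hx, rfl⟩
    obtain ⟨d, hd⟩ := h1 x hx
    exact Set.mem_iUnion.mpr ⟨d, x, ⟨hx, hd⟩, rfl⟩
  refine (Set.countable_iUnion fun d => Set.Subsingleton.countable ?_).mono this
  rintro _ ⟨x, ⟨hx, hdx⟩, rfl⟩ _ ⟨y, ⟨hy, hdy⟩, rfl⟩
  exact h2 x hx y hy d hdx hdy

/-- Closed subgroups which are conjugate to a relatively open subgroup of one of countably many
subgroups form countably many classes. -/
theorem countable_image_classes_of_relatively_open [IsTopologicalGroup G] (N : ℕ → Subgroup G)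
    [∀ m, (N m).FiniteIndex] (𝓔 : Set (Subgroup G)) (h𝓔 : 𝓔.Countable) (S : Set (ClosedSubgroup G))
    (hS : ∀ H ∈ S, ∃ g : G, ∃ E ∈ 𝓔, ∃ m, (H.conj g).toSubgroup ≤ E ∧
      E ⊓ N m ≤ (H.conj g).toSubgroup) :
    ((fun H => (⟦H⟧ : ClosedSubgroupClasses G)) '' S).Countable := by
  have : Countable 𝓔 := h𝓔
  have (m : ℕ) : Finite (G ⧸ N m) := inferInstance
  refine Set.Countable.image_of_relation (D := 𝓔 × Σ m, Set (G ⧸ N m)) _ S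
    (fun H d => ∃ g : G, (H.conj g).toSubgroup ≤ d.1 ∧ (d.1 : Subgroup G) ⊓ N d.2.1 ≤
      (H.conj g).toSubgroup ∧ (QuotientGroup.mk '' (H.conj g).toSubgroup.carrier) = d.2.2) ?_ ?_
  · intro H hH
    obtain ⟨g, E, hE, m, h1, h2⟩ := hS H hH
    exact ⟨(⟨E, hE⟩, ⟨m, QuotientGroup.mk '' (H.conj g).toSubgroup.carrier⟩), g, h1, h2, rfl⟩
  -- A subgroup lying between E ⊓ N m and E is determined by its image in the finite quotient by N
  -- m.
  · have key : ∀ (H₁ H₂ : ClosedSubgroup G) (E : Subgroup G) (m : ℕ), H₁.toSubgroup ≤ E →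
        H₂.toSubgroup ≤ E → E ⊓ N m ≤ H₁.toSubgroup →
        (QuotientGroup.mk '' H₂.toSubgroup.carrier : Set (G ⧸ N m)) ⊆
          QuotientGroup.mk '' H₁.toSubgroup.carrier → H₂.toSubgroup ≤ H₁.toSubgroup := by
      intro H₁ H₂ E m h1 h2 h3 h4 x hx
      obtain ⟨y, hy, hxy⟩ := h4 ⟨x, hx, rfl⟩
      have hmem : y⁻¹ * x ∈ E ⊓ N m :=
        ⟨E.mul_mem (E.inv_mem (h1 hy)) (h2 hx), QuotientGroup.eq.mp hxy⟩
      simpa using mul_mem (show y ∈ H₁.toSubgroup from hy) (h3 hmem)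
    rintro H₁ - H₂ - ⟨⟨E, hE⟩, m, T⟩ ⟨g₁, a1, a2, a3⟩ ⟨g₂, b1, b2, b3⟩
    have : H₁.conj g₁ = H₂.conj g₂ := by
      ext1
      exact le_antisymm (key _ _ E m b1 a1 b2 (by rw [a3, b3])) (key _ _ E m a1 b1 a2 (by rw [a3, b3]))
    show (⟦H₁⟧ : ClosedSubgroupClasses G) = ⟦H₂⟧
    rw [← H₁.mk_conj g₁, this, H₂.mk_conj g₂]

end ConjugacyClasses

section Congruence

variable {p : ℕ} [Fact p.Prime] {n : ℕ}

instance (m : ℕ) : (padicCongruenceSubgroup n p m).FiniteIndex := by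
  have : NeZero (p ^ m) := ⟨pow_ne_zero _ (Fact.out : p.Prime).ne_zero⟩
  have : Finite (SpecialLinearGroup (Fin n) (ZMod (p ^ m))) := Subtype.finite
  unfold padicCongruenceSubgroup
  exact Subgroup.finiteIndex_ker _

end Congruence

/-! ### Ambient subgroups of SL₂ and relative openness in them. -/

section TwoByTwoSubgroups

variable {p : ℕ} [Fact p.Prime]

local notation "M₂" => Matrix (Fin 2) (Fin 2) ℤ_[p]
local notation "G₂" => SpecialLinearGroup (Fin 2) ℤ_[p]

/-- The subgroup of upper triangular matrices. -/
def upperTriangularSubgroup (p : ℕ) [Fact p.Prime] :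
    Subgroup (SpecialLinearGroup (Fin 2) ℤ_[p]) where
  carrier := {g | (g : Matrix (Fin 2) (Fin 2) ℤ_[p]) 1 0 = 0}
  one_mem' := by simp
  mul_mem' := by
    intro a b ha hb
    simp only [Set.mem_ofPred_eq] at ha hb ⊢
    simp [Matrix.mul_apply, Fin.sum_univ_two, ha, hb]
  inv_mem' := by
    intro a ha
    simp only [Set.mem_ofPred_eq] at ha ⊢
    simp [Matrix.SpecialLinearGroup.coe_inv, Matrix.adjugate_fin_two, ha]

theorem Matrix.SpecialLinearGroup.mul_eq_one_of_upper {g : G₂} (hg : (g : M₂) 1 0 = 0) :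
    (g : M₂) 0 0 * (g : M₂) 1 1 = 1 := by
  have := Matrix.SpecialLinearGroup.det_coe g
  rw [Matrix.det_fin_two, hg] at this
  linear_combination this

/-- The subgroup of upper triangular matrices whose diagonal entries are roots of unity. -/
def torsionUpperTriangularSubgroup (p : ℕ) [Fact p.Prime] :
    Subgroup (SpecialLinearGroup (Fin 2) ℤ_[p]) where
  carrier := {g | (g : Matrix (Fin 2) (Fin 2) ℤ_[p]) 1 0 = 0 ∧
    ∃ N, 0 < N ∧ (g : Matrix (Fin 2) (Fin 2) ℤ_[p]) 0 0 ^ N = 1}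
  one_mem' := ⟨by simp, 1, one_pos, by simp⟩
  mul_mem' := by
    rintro a b ⟨ha, N, hN, haN⟩ ⟨hb, N', hN', hbN⟩
    refine ⟨(upperTriangularSubgroup p).mul_mem ha hb, N * N', by positivity, ?_⟩
    simp only [Matrix.SpecialLinearGroup.coe_mul, Matrix.mul_apply, Fin.sum_univ_two, hb, mul_zero,
      add_zero]
    rw [mul_pow, pow_mul, haN, one_pow, mul_comm N, pow_mul, hbN, one_pow, one_mul]
  inv_mem' := by
    rintro a ⟨ha, N, hN, haN⟩
    refine ⟨(upperTriangularSubgroup p).inv_mem ha, N, hN, ?_⟩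
    have h := Matrix.SpecialLinearGroup.mul_eq_one_of_upper ha
    have h2 : ((a⁻¹ : SpecialLinearGroup (Fin 2) ℤ_[p]) : Matrix (Fin 2) (Fin 2) ℤ_[p]) 0 0 =
        (a : Matrix (Fin 2) (Fin 2) ℤ_[p]) 1 1 := by
      simp [Matrix.SpecialLinearGroup.coe_inv, Matrix.adjugate_fin_two]
    rw [h2]
    have := congrArg (· ^ N) h
    simpa [mul_pow, haN] using this

/-- The subgroup of elements commuting or anticommuting with `X`. -/
def signedCentralizer (X : Matrix (Fin 2) (Fin 2) ℤ_[p]) :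
    Subgroup (SpecialLinearGroup (Fin 2) ℤ_[p]) where
  carrier := {g | (g : Matrix (Fin 2) (Fin 2) ℤ_[p]) * X = X * g ∨
    (g : Matrix (Fin 2) (Fin 2) ℤ_[p]) * X = -(X * g)}
  one_mem' := by simp
  mul_mem' := by
    intro a b ha hb
    simp only [Set.mem_ofPred_eq, Matrix.SpecialLinearGroup.coe_mul] at ha hb ⊢
    rw [mul_assoc, ← mul_assoc X]
    rcases ha with ha | ha <;> rcases hb with hb | hb <;> rw [hb]
    · left; rw [← ha, mul_assoc]
    · right; rw [mul_neg, ← ha, mul_assoc]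
    · right; rw [← mul_assoc, ha, neg_mul]
    · left; rw [mul_neg, ← mul_assoc, ha, neg_mul, neg_neg]
  inv_mem' := by
    intro a ha
    have h1 : (a : M₂) * ((a⁻¹ : G₂) : M₂) = 1 := by
      rw [← Matrix.SpecialLinearGroup.coe_mul, mul_inv_cancel, Matrix.SpecialLinearGroup.coe_one]
    have h2 : ((a⁻¹ : G₂) : M₂) * (a : M₂) = 1 := by
      rw [← Matrix.SpecialLinearGroup.coe_mul, inv_mul_cancel, Matrix.SpecialLinearGroup.coe_one]
    simp only [Set.mem_ofPred_eq] at ha ⊢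
    have h3 : ((a⁻¹ : G₂) : M₂) * X = ((a⁻¹ : G₂) : M₂) * (X * a) * ((a⁻¹ : G₂) : M₂) := by
      rw [mul_assoc, mul_assoc, h1, mul_one]
    have h4 : X * ((a⁻¹ : G₂) : M₂) = ((a⁻¹ : G₂) : M₂) * (a * X) * ((a⁻¹ : G₂) : M₂) := by
      rw [← mul_assoc _ (a : M₂), h2, one_mul]
    rcases ha with ha | ha
    · left; rw [h3, h4, ha]
    · right; rw [h3, h4, ha]; simp

variable {H : ClosedSubgroup (SpecialLinearGroup (Fin 2) ℤ_[p])}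

theorem Matrix.SpecialLinearGroup.conj_mul_coe (h x : G₂) :
    ((h * x * h⁻¹ : G₂) : M₂) * (h : M₂) = h * x := by
  rw [← Matrix.SpecialLinearGroup.coe_mul, inv_mul_cancel_right, Matrix.SpecialLinearGroup.coe_mul]

/-- A scalar in SL₂ squares to 1, and 1 is the only square root of 1 congruent to 1 modulo p². -/
theorem eq_one_of_scalar {x : G₂} (hx : x ∈ padicCongruenceSubgroup 2 p 2)
    (h01 : (x : M₂) 0 1 = 0) (h10 : (x : M₂) 1 0 = 0) (hd : (x : M₂) 0 0 = (x : M₂) 1 1) :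
    x = 1 := by
  obtain ⟨w, hw⟩ := mem_padicCongruenceSubgroup.mp hx
  have h1 : (x : M₂) 0 0 = 1 := by
    refine PadicInt.eq_one_of_pow_eq_one (k := 2) ⟨w 0 0, by rw [hw]; simp⟩ two_pos ?_
    rw [sq]
    nth_rewrite 2 [hd]
    exact Matrix.SpecialLinearGroup.mul_eq_one_of_upper h10
  ext i j
  fin_cases i <;> fin_cases j <;> simp [h01, h10, h1, ← hd]

/-- Cramer's rule for trace zero matrices, modulo scalars. -/
theorem Matrix.trace_smul_eq_fin_two {R : Type*} [CommRing R] (x y z w : Matrix (Fin 2) (Fin 2) R) :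
    ∃ s : R, ((x * y - y * x) * z).trace • w = ((y * z - z * y) * w).trace • x +
      ((z * x - x * z) * w).trace • y + ((x * y - y * x) * w).trace • z + s • 1 := by
  have h : ∀ a b c : Matrix (Fin 2) (Fin 2) R, ((a * b - b * a) * c).trace =
      (a 0 1 * b 1 0 - b 0 1 * a 1 0) * (c 0 0 - c 1 1) +
      ((a 0 0 - a 1 1) * b 0 1 - (b 0 0 - b 1 1) * a 0 1) * c 1 0 -
      ((a 0 0 - a 1 1) * b 1 0 - (b 0 0 - b 1 1) * a 1 0) * c 0 1 := by
    intro a b c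
    simp only [Matrix.trace_fin_two, Matrix.mul_apply, Fin.sum_univ_two, Matrix.sub_apply]
    ring
  refine ⟨((x * y - y * x) * z).trace * w 0 0 - ((y * z - z * y) * w).trace * x 0 0 -
    ((z * x - x * z) * w).trace * y 0 0 - ((x * y - y * x) * w).trace * z 0 0, ?_⟩
  simp only [h]
  ext i j
  fin_cases i <;> fin_cases j <;>
    simp only [Matrix.add_apply, Matrix.smul_apply, Matrix.one_apply, smul_eq_mul, Fin.zero_eta,
      Fin.mk_one, if_true, zero_ne_one, one_ne_zero, if_false] <;> ring

/-- `H` is open as soon as three of its elements have independent trace zero parts. -/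
theorem exists_congruence_le_of_trace_ne_zero {x y z : G₂} (hx : x ∈ H.toSubgroup)
    (hy : y ∈ H.toSubgroup) (hz : z ∈ H.toSubgroup)
    (hx2 : x ∈ padicCongruenceSubgroup 2 p 2) (hy2 : y ∈ padicCongruenceSubgroup 2 p 2)
    (hz2 : z ∈ padicCongruenceSubgroup 2 p 2)
    (htr : (((x : M₂) * y - y * x) * z).trace ≠ 0) :
    ∃ m, padicCongruenceSubgroup 2 p m ≤ H.toSubgroup := by
  obtain ⟨m, -, hm⟩ := H.exists_forall_mem_of_span ⊤ (fun _ _ => trivial) (fun _ _ _ => trivial) htr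
    (by
      intro w _
      obtain ⟨s, e⟩ := Matrix.trace_smul_eq_fin_two (x : M₂) y z w
      rw [e]
      refine add_mem (add_mem (add_mem ?_ ?_) ?_) ?_ <;> refine Submodule.smul_mem _ _ ?_
      exacts [Submodule.subset_span ⟨x, hx, hx2, rfl⟩, Submodule.subset_span ⟨y, hy, hy2, rfl⟩,
        Submodule.subset_span ⟨z, hz, hz2, rfl⟩,
        Submodule.subset_span ⟨1, one_mem _, one_mem _, by simp⟩])
  exact ⟨m, fun z hz => hm z hz trivial⟩

/-- The two-dimensional case. The commutator of x and y is a nonzero multiple e of the elementary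
nilpotent matrix. H normalizes its intersection with the congruence subgroup, so each h in H carries
this commutator to another strictly upper triangular one, which forces h to be upper triangular. Up
to the denominator e, the matrices 1, x, y span the upper triangular algebra. -/
theorem le_upper_and_upper_inf_le {x y : G₂} (hx : x ∈ H.toSubgroup)
    (hy : y ∈ H.toSubgroup)
    (hx2 : x ∈ padicCongruenceSubgroup 2 p 2) (hy2 : y ∈ padicCongruenceSubgroup 2 p 2)
    (hup : ∀ z ∈ H.toSubgroup, z ∈ padicCongruenceSubgroup 2 p 2 → (z : M₂) 1 0 = 0)
    (hxy : (x : M₂) * y ≠ y * x) :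
    H.toSubgroup ≤ upperTriangularSubgroup p ∧
      ∃ m, upperTriangularSubgroup p ⊓ padicCongruenceSubgroup 2 p m ≤ H.toSubgroup := by
  have hx0 := hup x hx hx2
  have hy0 := hup y hy hy2
  have he : ((x : M₂) 0 0 - (x : M₂) 1 1) * (y : M₂) 0 1 -
      ((y : M₂) 0 0 - (y : M₂) 1 1) * (x : M₂) 0 1 ≠ 0 := by
    intro h
    apply hxy
    ext i j
    fin_cases i <;> fin_cases j <;>
      simp [Matrix.mul_apply, Fin.sum_univ_two, hx0, hy0, mul_comm]
    linear_combination h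
  constructor
  · intro h hh
    have hc : ∀ z ∈ H.toSubgroup, z ∈ padicCongruenceSubgroup 2 p 2 →
        ((h * z * h⁻¹ : G₂) : M₂) 1 0 = 0 := fun z hz hz2 =>
      hup _ (mul_mem (mul_mem hh hz) (inv_mem hh)) (Subgroup.Normal.conj_mem inferInstance z hz2 h)
    have e1 := Matrix.SpecialLinearGroup.conj_mul_coe h x
    have e2 := Matrix.SpecialLinearGroup.conj_mul_coe h y
    have hx' := hc x hx hx2
    have hy' := hc y hy hy2
    generalize ((h * x * h⁻¹ : G₂) : M₂) = x' at *
    generalize ((h * y * h⁻¹ : G₂) : M₂) = y' at *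
    have e3 : (x' * y' - y' * x') * (h : M₂) = h * ((x : M₂) * y - y * x) := by
      rw [sub_mul, mul_assoc, e2, ← mul_assoc, e1, mul_assoc y', e1, ← mul_assoc y', e2, mul_sub]
      simp only [mul_assoc]
    have e4 := congrFun (congrFun e3 1) 1
    simp [Matrix.mul_apply, Fin.sum_univ_two, hx0, hy0, hx', hy'] at e4
    have e5 : (h : M₂) 1 0 * (((x : M₂) 0 0 - (x : M₂) 1 1) * (y : M₂) 0 1 -
      ((y : M₂) 0 0 - (y : M₂) 1 1) * (x : M₂) 0 1) = 0 := by linear_combination -e4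
    exact (mul_eq_zero.mp e5).resolve_right he
  · let A : Subalgebra ℤ_[p] M₂ :=
      { carrier := {w | w 1 0 = 0}
        mul_mem' := by
          intro a b ha hb
          simp only [Set.mem_ofPred_eq] at ha hb ⊢
          simp [Matrix.mul_apply, Fin.sum_univ_two, ha, hb]
        add_mem' := by
          intro a b ha hb
          simp only [Set.mem_ofPred_eq] at ha hb ⊢
          simp [ha, hb]
        algebraMap_mem' := by intro r; simp [Matrix.algebraMap_matrix_apply] }
    obtain ⟨m, -, hm⟩ := H.exists_forall_mem_of_span A
      (fun w hw => by
        have hw : ((p : ℤ_[p]) • w) 1 0 = 0 := hw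
        show w 1 0 = 0
        rw [Matrix.smul_apply, smul_eq_mul] at hw
        exact (mul_eq_zero.mp hw).resolve_left PadicInt.natCast_self_ne_zero)
      (fun z hz hz2 => hup z hz hz2) he (by
        intro w hw
        have hw : w 1 0 = 0 := hw
        have e : (((x : M₂) 0 0 - (x : M₂) 1 1) * (y : M₂) 0 1 -
            ((y : M₂) 0 0 - (y : M₂) 1 1) * (x : M₂) 0 1) • w =
            ((w 0 0 - w 1 1) * (y : M₂) 0 1 - w 0 1 * ((y : M₂) 0 0 - (y : M₂) 1 1)) • (x : M₂) +
            (w 0 1 * ((x : M₂) 0 0 - (x : M₂) 1 1) - (w 0 0 - w 1 1) * (x : M₂) 0 1) • (y : M₂) +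
            ((((x : M₂) 0 0 - (x : M₂) 1 1) * (y : M₂) 0 1 -
            ((y : M₂) 0 0 - (y : M₂) 1 1) * (x : M₂) 0 1) * w 0 0 -
            ((w 0 0 - w 1 1) * (y : M₂) 0 1 - w 0 1 * ((y : M₂) 0 0 - (y : M₂) 1 1)) * (x : M₂) 0 0 -
            (w 0 1 * ((x : M₂) 0 0 - (x : M₂) 1 1) - (w 0 0 - w 1 1) * (x : M₂) 0 1) * (y : M₂) 0 0) •
              ((1 : G₂) : M₂) := by
          ext i j
          fin_cases i <;> fin_cases j <;> simp [hx0, hy0, hw] <;> ring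
        rw [e]
        refine add_mem (add_mem ?_ ?_) ?_ <;> refine Submodule.smul_mem _ _ ?_
        exacts [Submodule.subset_span ⟨x, hx, hx2, rfl⟩, Submodule.subset_span ⟨y, hy, hy2, rfl⟩,
          Submodule.subset_span ⟨1, one_mem _, one_mem _, rfl⟩])
    exact ⟨m, fun z hz => hm z hz.2 hz.1⟩

/-- If the elements of `H` close to `1` commute with one of them, `x`, which is not scalar,
then `H` contains all elements of the centralizer of `x` close to `1`. -/
theorem exists_forall_mem_of_commute {x : G₂} (hx : x ∈ H.toSubgroup)
    (hx2 : x ∈ padicCongruenceSubgroup 2 p 2) (hx1 : x ≠ 1)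
    (hcomm : ∀ z ∈ H.toSubgroup, z ∈ padicCongruenceSubgroup 2 p 2 → (x : M₂) * z = z * x) :
    ∃ m, 2 ≤ m ∧ ∀ z ∈ padicCongruenceSubgroup 2 p m, (x : M₂) * z = z * x → z ∈ H.toSubgroup := by
  -- The commutant of a non-scalar 2 × 2 matrix is spanned by 1 and x once a nonzero d among x₀₀ -
  -- x₁₁, x₁₀, x₀₁ is inverted; the cases at the end choose d.
  have key : ∀ (d : ℤ_[p]), d ≠ 0 → (∀ w : M₂, (x : M₂) * w = w * x →
      ∃ a s : ℤ_[p], d • w = a • (x : M₂) + s • 1) →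
      ∃ m, 2 ≤ m ∧ ∀ z ∈ padicCongruenceSubgroup 2 p m, (x : M₂) * z = z * x → z ∈ H.toSubgroup := by
    intro d hd h
    obtain ⟨m, hm2, hm⟩ := H.exists_forall_mem_of_span (Subalgebra.centralizer ℤ_[p] {(x : M₂)})
      (fun w hw => by
        rw [Subalgebra.mem_centralizer_iff] at hw ⊢
        intro g hg
        have := hw g hg
        rw [Matrix.mul_smul, Matrix.smul_mul] at this
        exact smul_right_injective _ PadicInt.natCast_self_ne_zero this)
      (fun z hz hz2 => by
        rw [Subalgebra.mem_centralizer_iff]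
        rintro g rfl
        exact hcomm z hz hz2) hd
      (fun w hw => by
        rw [Subalgebra.mem_centralizer_iff] at hw
        obtain ⟨a, s, e⟩ := h w (hw x rfl)
        rw [e]
        refine add_mem (Submodule.smul_mem _ _ (Submodule.subset_span ⟨x, hx, hx2, rfl⟩))
          (Submodule.smul_mem _ _ (Submodule.subset_span ⟨1, one_mem _, one_mem _, ?_⟩))
        simp)
    refine ⟨m, hm2, fun z hz hzx => hm z hz ?_⟩
    rw [Subalgebra.mem_centralizer_iff]
    rintro g rfl
    exact hzx
  have hentries : ∀ w : M₂, (x : M₂) * w = w * x →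
      (x : M₂) 0 1 * w 1 0 = w 0 1 * (x : M₂) 1 0 ∧
      ((x : M₂) 0 0 - (x : M₂) 1 1) * w 0 1 = (w 0 0 - w 1 1) * (x : M₂) 0 1 ∧
      ((x : M₂) 0 0 - (x : M₂) 1 1) * w 1 0 = (w 0 0 - w 1 1) * (x : M₂) 1 0 := by
    intro w hw
    have h00 := congrFun (congrFun hw 0) 0
    have h01 := congrFun (congrFun hw 0) 1
    have h10 := congrFun (congrFun hw 1) 0
    simp only [Matrix.mul_apply, Fin.sum_univ_two] at h00 h01 h10
    exact ⟨by linear_combination h00, by linear_combination h01, by linear_combination -h10⟩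
  by_cases h01 : (x : M₂) 0 1 = 0
  · by_cases h10 : (x : M₂) 1 0 = 0
    · have hd : (x : M₂) 0 0 - (x : M₂) 1 1 ≠ 0 :=
        fun h => hx1 (eq_one_of_scalar hx2 h01 h10 (sub_eq_zero.mp h))
      refine key _ hd fun w hw => ⟨w 0 0 - w 1 1, ((x : M₂) 0 0 - (x : M₂) 1 1) * w 0 0 -
        (w 0 0 - w 1 1) * (x : M₂) 0 0, ?_⟩
      obtain ⟨e1, e2, e3⟩ := hentries w hw
      ext i j
      fin_cases i <;> fin_cases j <;> simp
      · linear_combination e2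
      · linear_combination e3
      · ring
    · refine key _ h10 fun w hw => ⟨w 1 0, (x : M₂) 1 0 * w 0 0 - w 1 0 * (x : M₂) 0 0, ?_⟩
      obtain ⟨e1, e2, e3⟩ := hentries w hw
      ext i j
      fin_cases i <;> fin_cases j <;> simp
      · linear_combination -e1
      · linear_combination mul_comm ((x : M₂) 1 0) (w 1 0)
      · linear_combination e3
  · refine key _ h01 fun w hw => ⟨w 0 1, (x : M₂) 0 1 * w 0 0 - w 0 1 * (x : M₂) 0 0, ?_⟩
    obtain ⟨e1, e2, e3⟩ := hentries w hw
    ext i j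
    fin_cases i <;> fin_cases j <;> simp
    · linear_combination mul_comm ((x : M₂) 0 1) (w 0 1)
    · linear_combination e1
    · linear_combination e2

/-- The unipotent one-dimensional case. For h in H the conjugate of x by h commutes with x, so h
fixes the line of the first basis vector. A power of h commutes with x, so its diagonal entries are
equal with product 1, and those of h are roots of unity. Conversely, near 1 a root of unity on the
diagonal must be 1, so the matrix commutes with x. -/
theorem le_torsionUpper_and_inf_le {x : G₂} (hx : x ∈ H.toSubgroup)
    (hx2 : x ∈ padicCongruenceSubgroup 2 p 2) (hx10 : (x : M₂) 1 0 = 0)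
    (hx00 : (x : M₂) 0 0 = (x : M₂) 1 1) (hx01 : (x : M₂) 0 1 ≠ 0)
    (hcomm : ∀ z ∈ H.toSubgroup, z ∈ padicCongruenceSubgroup 2 p 2 → (x : M₂) * z = z * x) :
    H.toSubgroup ≤ torsionUpperTriangularSubgroup p ∧
      ∃ m, torsionUpperTriangularSubgroup p ⊓ padicCongruenceSubgroup 2 p m ≤ H.toSubgroup := by
  have hent : ∀ w : M₂, (x : M₂) * w = w * x → w 1 0 = 0 ∧ w 0 0 = w 1 1 := by
    intro w hw
    have h00 := congrFun (congrFun hw 0) 0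
    have h01 := congrFun (congrFun hw 0) 1
    simp only [Matrix.mul_apply, Fin.sum_univ_two, hx10, hx00] at h00 h01
    have h1 : (x : M₂) 0 1 * w 1 0 = 0 := by linear_combination h00
    have h2 : (x : M₂) 0 1 * (w 0 0 - w 1 1) = 0 := by linear_combination -h01
    exact ⟨(mul_eq_zero.mp h1).resolve_left hx01,
      sub_eq_zero.mp ((mul_eq_zero.mp h2).resolve_left hx01)⟩
  constructor
  · intro h hh
    have h10 : (h : M₂) 1 0 = 0 := by
      obtain ⟨a1, a2⟩ := hent _ (hcomm _ (mul_mem (mul_mem hh hx) (inv_mem hh))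
        (Subgroup.Normal.conj_mem inferInstance x hx2 h))
      have e := Matrix.SpecialLinearGroup.conj_mul_coe h x
      generalize ((h * x * h⁻¹ : G₂) : M₂) = x' at *
      have e10 := congrFun (congrFun e 1) 0
      have e11 := congrFun (congrFun e 1) 1
      simp only [Matrix.mul_apply, Fin.sum_univ_two, hx10, a1] at e10 e11
      have : (h : M₂) 1 0 ^ 2 * (x : M₂) 0 1 = 0 := by
        linear_combination (h : M₂) 1 1 * e10 - (h : M₂) 1 0 * e11 +
          (h : M₂) 1 0 * (h : M₂) 1 1 * hx00
      exact pow_eq_zero_iff two_ne_zero |>.mp ((mul_eq_zero.mp this).resolve_right hx01)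
    refine ⟨h10, ?_⟩
    obtain ⟨N, hN, hNpos⟩ : ∃ N, h ^ N ∈ padicCongruenceSubgroup 2 p 2 ∧ 0 < N :=
      ⟨_, (padicCongruenceSubgroup 2 p 2).pow_index_mem h,
        Nat.pos_of_ne_zero Subgroup.FiniteIndex.index_ne_zero⟩
    have hpow : ∀ k : ℕ, ((h ^ k : G₂) : M₂) 0 0 = (h : M₂) 0 0 ^ k := by
      intro k
      induction k with
      | zero => simp
      | succ k ih =>
        rw [pow_succ, pow_succ, Matrix.SpecialLinearGroup.coe_mul, Matrix.mul_apply,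
          Fin.sum_univ_two, ih, h10, mul_zero, add_zero]
    obtain ⟨b1, b2⟩ := hent _ (hcomm _ (pow_mem hh N) hN)
    refine ⟨N * 2, by positivity, ?_⟩
    have := Matrix.SpecialLinearGroup.mul_eq_one_of_upper b1
    rw [← b2, hpow] at this
    rw [pow_mul, sq, this]
  · obtain ⟨m, hm2, hm⟩ := exists_forall_mem_of_commute hx hx2
      (by rintro rfl; simp at hx01) hcomm
    refine ⟨m, fun z hz => hm z hz.2 ?_⟩
    obtain ⟨⟨hz10, N, hN, hzN⟩, hzm⟩ := hz
    obtain ⟨w, hw⟩ := mem_padicCongruenceSubgroup.mp (padicCongruenceSubgroup_antitone hm2 hzm)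
    have hz00 : (z : M₂) 0 0 = 1 :=
      PadicInt.eq_one_of_pow_eq_one ⟨w 0 0, by rw [hw]; simp⟩ hN hzN
    have hz11 := Matrix.SpecialLinearGroup.mul_eq_one_of_upper hz10
    rw [hz00, one_mul] at hz11
    ext i j
    fin_cases i <;> fin_cases j <;>
      simp [Matrix.mul_apply, Fin.sum_univ_two, hz00, hz11, hz10, hx10, hx00]
    ring

/-- Here XY is a scalar s, and X² = -d yields dY = -sX; equality of determinants then gives s² = d².
Applied to the conjugates of X under H, this is why `signedCentralizer` allows a sign. -/
theorem Matrix.eq_or_eq_neg_of_commute_of_trace_eq_zero {R : Type*} [CommRing R] [IsDomain R]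
    {X Y : Matrix (Fin 2) (Fin 2) R} (hX : X 1 1 = -X 0 0) (hY : Y 1 1 = -Y 0 0)
    (hXY : X * Y = Y * X) (h2 : (2 : R) ≠ 0) (hdet : X.det = Y.det) (hd : X.det ≠ 0) :
    Y = X ∨ Y = -X := by
  have h00 := congrFun (congrFun hXY 0) 0
  have h01 := congrFun (congrFun hXY 0) 1
  have h10 := congrFun (congrFun hXY 1) 0
  simp only [Matrix.mul_apply, Fin.sum_univ_two, hX, hY] at h00 h01 h10
  have e01 : X 0 0 * Y 0 1 = Y 0 0 * X 0 1 := by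
    apply mul_left_cancel₀ h2; linear_combination h01
  have e10 : X 0 0 * Y 1 0 = Y 0 0 * X 1 0 := by
    apply mul_left_cancel₀ h2; linear_combination -h10
  set d := X.det with hdX
  have hYd := hdet.symm
  rw [Matrix.det_fin_two, hX] at hdX
  rw [Matrix.det_fin_two, hY] at hYd
  set s := X 0 0 * Y 0 0 + X 0 1 * Y 1 0 with hs
  have hsd : s = d ∨ s = -d := by
    rw [← sq_eq_sq_iff_eq_or_eq_neg]
    have : d ^ 2 = (X 0 0 * -X 0 0 - X 0 1 * X 1 0) * (Y 0 0 * -Y 0 0 - Y 0 1 * Y 1 0) := by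
      rw [← hdX, hYd, sq]
    rw [this, hs]
    linear_combination X 0 1 * Y 1 0 * h00 - X 0 0 * Y 1 0 * e01 - X 0 1 * Y 0 0 * e10 + 2 * Y 0 0 * X 0 1 * e10
  have hYX : ∀ i j, d * Y i j = - s * X i j := by
    intro i j
    rw [hdX, hs]
    fin_cases i <;> fin_cases j <;> simp [hX, hY]
    · linear_combination X 0 1 * e10
    · linear_combination X 0 1 * h00 - X 0 0 * e01
    · linear_combination -X 0 0 * e10
    · linear_combination X 0 1 * e10
  rcases hsd with h | h
  · right; ext i j
    apply mul_left_cancel₀ hd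
    rw [hYX, h]; simp
  · left; ext i j
    apply mul_left_cancel₀ hd
    rw [hYX, h]; simp

end TwoByTwoSubgroups

/-! ### Normal forms of trace-zero matrices under SL₂(ℤ_p). -/

section TwoByTwoConjugation

variable {p : ℕ} [Fact p.Prime]

local notation "M₂" => Matrix (Fin 2) (Fin 2) ℤ_[p]
local notation "G₂" => SpecialLinearGroup (Fin 2) ℤ_[p]

/-- A nilpotent X kills its own columns. Divisibility in ℤ_p is total, so the kernel contains a
vector (1, t) or (t, 1), which some g in SL₂ moves to the first basis vector. -/
theorem exists_mul_eq_smul_nilpotent_mul {X : M₂} (hX : X ≠ 0) (htr : X 1 1 = -X 0 0)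
    (hdet : X.det = 0) :
    ∃ g : G₂, ∃ e : ℤ_[p], e ≠ 0 ∧ (g : M₂) * X = (e • !![0, 1; 0, 0]) * (g : M₂) := by
  rw [Matrix.det_fin_two, htr] at hdet
  have hker : ∀ t, X 0 0 + X 0 1 * t = 0 → X 1 0 + X 1 1 * t = 0 →
      ∃ g : G₂, ∃ e : ℤ_[p], e ≠ 0 ∧ (g : M₂) * X = (e • !![0, 1; 0, 0]) * (g : M₂) := by
    intro t h1 h2
    refine ⟨⟨!![1, 0; -t, 1], by simp [Matrix.det_fin_two]⟩, X 0 1, ?_, ?_⟩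
    · intro h
      apply hX
      have h00 : X 0 0 = 0 := by rw [h] at h1; simpa using h1
      have h10 : X 1 0 = 0 := by rw [htr, h00] at h2; simpa using h2
      ext i j
      fin_cases i <;> fin_cases j <;> simp [h, h00, h10, htr]
    · ext i j
      fin_cases i <;> fin_cases j <;> simp [Matrix.mul_apply, Fin.sum_univ_two]
      · linear_combination h1
      · linear_combination h2 - t * htr
      · linear_combination htr - h1
  have hker' : ∀ t, X 0 0 * t + X 0 1 = 0 → X 1 0 * t + X 1 1 = 0 →
      ∃ g : G₂, ∃ e : ℤ_[p], e ≠ 0 ∧ (g : M₂) * X = (e • !![0, 1; 0, 0]) * (g : M₂) := by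
    intro t h1 h2
    refine ⟨⟨!![0, 1; -1, t], by simp [Matrix.det_fin_two]⟩, -X 1 0, ?_, ?_⟩
    · intro h
      have h10 : X 1 0 = 0 := neg_eq_zero.mp h
      apply hX
      have h11 : X 1 1 = 0 := by rw [h10] at h2; simpa using h2
      have h00 : X 0 0 = 0 := by rw [h11] at htr; simpa using htr.symm
      have h01 : X 0 1 = 0 := by rw [h00] at h1; simpa using h1
      ext i j
      fin_cases i <;> fin_cases j <;> simp [h00, h01, h10, h11]
    · ext i j
      fin_cases i <;> fin_cases j <;> simp [Matrix.mul_apply, Fin.sum_univ_two]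
      · linear_combination h2
      · linear_combination h2 - htr
      · linear_combination t * htr - h1
  by_cases h0 : X 0 0 = 0 ∧ X 1 0 = 0
  · exact hker 0 (by simp [h0.1]) (by simp [h0.2])
  rcases ValuationRing.dvd_total (X 0 0) (X 1 0) with ⟨t, ht⟩ | ⟨t, ht⟩
  · have h00 : X 0 0 ≠ 0 := by rintro h; rw [h, zero_mul] at ht; exact h0 ⟨h, ht⟩
    refine hker t ?_ ?_
    · apply mul_left_cancel₀ h00
      rw [ht] at hdet
      linear_combination -hdet
    · rw [ht, htr]; ring
  · have h10 : X 1 0 ≠ 0 := by rintro h; rw [h, zero_mul] at ht; exact h0 ⟨ht, h⟩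
    refine hker' t ?_ ?_
    · apply mul_left_cancel₀ h10
      linear_combination -hdet - X 0 0 * ht
    · rw [htr, ht]; ring

/-- A matrix close to a nonzero scalar is a multiple of an element of `SL₂`. -/
theorem exists_eq_smul_of_near_scalar {N : ℤ_[p]} (hN : N ≠ 0) (Y : M₂) :
    ∃ g : G₂, ∃ c : ℤ_[p], c ≠ 0 ∧ N • (1 : M₂) + (N * (p : ℤ_[p]) ^ 3) • Y = c • (g : M₂) := by
  set T : M₂ := 1 + (p : ℤ_[p]) ^ 3 • Y with hT
  obtain ⟨s, hs⟩ : ∃ s, T.det = 1 + (p : ℤ_[p]) ^ 3 * s := by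
    refine ⟨Y 0 0 + Y 1 1 + (p : ℤ_[p]) ^ 3 * (Y 0 0 * Y 1 1 - Y 0 1 * Y 1 0), ?_⟩
    rw [Matrix.det_fin_two, hT]
    simp
    ring
  -- As det T ≡ 1 modulo p³ it has a square root, and dividing T by it makes the determinant 1.
  obtain ⟨w, hw⟩ := PadicInt.exists_sq_eq (u := T.det) (by rw [hs]; simp)
  have hu : IsUnit T.det := by
    rw [hs, show (p : ℤ_[p]) ^ 3 * s = p * ((p : ℤ_[p]) ^ 2 * s) by ring]
    exact PadicInt.isUnit_one_add_mul _
  obtain ⟨v, rfl⟩ : IsUnit w := by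
    rw [← hw] at hu
    exact (isUnit_pow_iff two_ne_zero).mp hu
  refine ⟨⟨((v⁻¹ : ℤ_[p]ˣ) : ℤ_[p]) • T, ?_⟩, N * v, mul_ne_zero hN v.ne_zero, ?_⟩
  · rw [Matrix.det_smul, ← hw, Fintype.card_fin, ← mul_pow, Units.inv_mul, one_pow]
  · change _ = (N * (v : ℤ_[p])) • (((v⁻¹ : ℤ_[p]ˣ) : ℤ_[p]) • T)
    rw [smul_smul, mul_assoc, Units.mul_inv, mul_one, hT, smul_add, smul_smul]

/-- Approximate X by an integer trace-zero X₀, close enough that det X₀ = w² det X. Then wX and X₀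
have the same square, so T = X₀(wX) - det X₀ satisfies T(wX) = X₀T. Since T is close to a nonzero
scalar, it is a multiple of an element of SL₂. Up to conjugacy and scaling only countably many X
therefore occur. -/
theorem exists_smul_mul_eq_intCast_mul {X : M₂} (htr : X 1 1 = -X 0 0) (hdet : X.det ≠ 0) :
    ∃ (g : G₂) (X₀ : Matrix (Fin 2) (Fin 2) ℤ) (w : ℤ_[p]), w ≠ 0 ∧
      w • ((g : M₂) * X) = X₀.map (Int.cast : ℤ → ℤ_[p]) * (g : M₂) := by
  set d := X.det with hd
  set q := (p : ℤ_[p]) with hq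
  obtain ⟨k, D, hk⟩ := PadicInt.exists_dvd_pow (mul_ne_zero hdet (two_ne_zero : (2 : ℤ_[p]) ≠ 0))
  have happr : ∀ x : ℤ_[p], ∃ (n : ℤ) (y : ℤ_[p]), (n : ℤ_[p]) = x - q ^ (k + 3) * y := by
    intro x
    obtain ⟨y, hy⟩ := Ideal.mem_span_singleton.mp (PadicInt.appr_spec (k + 3) x)
    exact ⟨x.appr (k + 3), y, by rw [← hy]; push_cast; ring⟩
  obtain ⟨a, a', ha⟩ := happr (X 0 0)
  obtain ⟨b, b', hb⟩ := happr (X 0 1)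
  obtain ⟨c, c', hc⟩ := happr (X 1 0)
  set X₀ : M₂ := (!![a, b; c, -a]).map (Int.cast : ℤ → ℤ_[p]) with hX₀
  set Y : M₂ := !![a', b'; c', -a'] with hY
  have hXY : X₀ = X - q ^ (k + 3) • Y := by
    ext i j
    fin_cases i <;> fin_cases j <;> simp [hX₀, hY, ha, hb, hc, htr]
    ring
  have hXX : X * X = -(d • (1 : M₂)) := by
    rw [Matrix.sq_eq_trace_smul_sub_det_fin_two, Matrix.trace_fin_two, htr]
    simp [hd]
  obtain ⟨s, hs⟩ : ∃ s, X₀.det = d + q ^ (k + 3) * s := by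
    refine ⟨2 * X 0 0 * a' + X 0 1 * c' + X 1 0 * b' - q ^ (k + 3) * (a' * a' + b' * c'), ?_⟩
    rw [hd, Matrix.det_fin_two, Matrix.det_fin_two, htr]
    simp [hX₀, ha, hb, hc]
    ring
  have hX₀X₀ : X₀ * X₀ = -(X₀.det • (1 : M₂)) := by
    rw [Matrix.sq_eq_trace_smul_sub_det_fin_two, Matrix.trace_fin_two]
    simp [hX₀]
  obtain ⟨w₀, hw₀⟩ := PadicInt.exists_sq_eq (p := p) (u := 1 + q ^ 3 * (2 * D * s)) (by simp [hq])
  have hdet₀ : X₀.det = d * w₀ ^ 2 := by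
    rw [hs, hw₀, pow_add, hk]; ring
  -- The sign of the square root is chosen so that 1 + w divides 2. The scalar N = -w d (1 + w) is
  -- then nonzero and divides p^k, because 2d does.
  obtain ⟨w, hw2, hw⟩ : ∃ w, w ^ 2 = w₀ ^ 2 ∧ (1 + w) ∣ 2 := by
    rcases ValuationRing.dvd_total (1 + w₀) (1 - w₀) with h | h
    · exact ⟨w₀, rfl, (by ring : (1 + w₀) + (1 - w₀) = 2) ▸ dvd_add dvd_rfl h⟩
    · exact ⟨-w₀, by ring, by
        rw [← sub_eq_add_neg]
        exact (by ring : (1 + w₀) + (1 - w₀) = 2) ▸ dvd_add h dvd_rfl⟩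
  have hwu : IsUnit w := by
    have : IsUnit (w ^ 2) := by
      rw [hw2, hw₀, show q ^ 3 * (2 * D * s) = q * (q ^ 2 * (2 * D * s)) by ring]
      exact PadicInt.isUnit_one_add_mul _
    exact (isUnit_pow_iff two_ne_zero).mp this
  obtain ⟨E, hE⟩ := hw
  obtain ⟨v, hv⟩ := hwu
  have h1w : 1 + w ≠ 0 := by rintro h; rw [h, zero_mul] at hE; exact two_ne_zero hE
  have hw0 : w ≠ 0 := by rw [← hv]; exact v.ne_zero
  set N : ℤ_[p] := -(w * d * (1 + w)) with hN
  have hN0 : N ≠ 0 := neg_ne_zero.mpr (mul_ne_zero (mul_ne_zero hw0 hdet) h1w)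
  have hqN : q ^ (k + 3) = N * q ^ 3 * (-((v⁻¹ : ℤ_[p]ˣ) : ℤ_[p]) * E * D) := by
    have hvw : w * ((v⁻¹ : ℤ_[p]ˣ) : ℤ_[p]) = 1 := by rw [← hv, Units.mul_inv]
    rw [pow_add, hk, hE, hN]
    linear_combination (-d * (1 + w) * E * D * q ^ 3) * hvw
  obtain ⟨g, e, he, hg⟩ := exists_eq_smul_of_near_scalar hN0
    ((-((v⁻¹ : ℤ_[p]ˣ) : ℤ_[p]) * E * D) • (-w • (Y * X)))
  have hT : e • (g : M₂) = w • (X₀ * X) - X₀.det • (1 : M₂) := by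
    rw [← hg, smul_smul, ← hqN, hXY, sub_mul, hXX, Matrix.smul_mul, ← hXY, hdet₀, ← hw2, hN]
    module
  refine ⟨g, !![a, b; c, -a], w, hw0, ?_⟩
  refine smul_right_injective _ he ?_
  show e • (w • ((g : M₂) * X)) = e • (X₀ * (g : M₂))
  have hL : (e • (g : M₂)) * X = -(w * d) • X₀ - X₀.det • X := by
    rw [hT, sub_mul, Matrix.smul_mul, mul_assoc, hXX, Matrix.smul_mul, one_mul, mul_neg,
      Matrix.mul_smul, mul_one]
    module
  have hR : X₀ * (e • (g : M₂)) = -(w * X₀.det) • X - X₀.det • X₀ := by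
    rw [hT, mul_sub, Matrix.mul_smul, ← mul_assoc, hX₀X₀, neg_mul, Matrix.smul_mul, one_mul,
      Matrix.mul_smul, mul_one]
    module
  calc e • (w • ((g : M₂) * X)) = w • ((e • (g : M₂)) * X) := by rw [Matrix.smul_mul, smul_comm]
    _ = X₀ * (e • (g : M₂)) := by rw [hL, hR, hdet₀, ← hw2]; module
    _ = e • (X₀ * (g : M₂)) := by rw [Matrix.mul_smul]

end TwoByTwoConjugation

/-! ### Closed subgroups of SL₂(ℤ_p) up to conjugacy. -/

section Classification

variable {p : ℕ} [Fact p.Prime]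

local notation "M₂" => Matrix (Fin 2) (Fin 2) ℤ_[p]
local notation "G₂" => SpecialLinearGroup (Fin 2) ℤ_[p]

/-- Subgroups such that every closed subgroup of `SL₂(ℤ_p)` is finite or conjugate to a relatively
open subgroup of one of them. -/
def ambientSubgroups (p : ℕ) [Fact p.Prime] :
    Set (Subgroup (SpecialLinearGroup (Fin 2) ℤ_[p])) :=
  {⊤, upperTriangularSubgroup p, torsionUpperTriangularSubgroup p} ∪
    Set.range fun X : Matrix (Fin 2) (Fin 2) ℤ => signedCentralizer (X.map (Int.cast : ℤ → ℤ_[p]))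

theorem countable_ambientSubgroups : (ambientSubgroups p).Countable :=
  have : Countable (Matrix (Fin 2) (Fin 2) ℤ) := inferInstanceAs (Countable (Fin 2 → Fin 2 → ℤ))
  (Set.Finite.countable (by simp)).union (Set.countable_range _)

theorem ClosedSubgroup.conj_mem_conj {G : Type*} [Group G] [TopologicalSpace G]
    [IsTopologicalGroup G] {H : ClosedSubgroup G} {x : G} (g : G) (hx : x ∈ H.toSubgroup) :
    g * x * g⁻¹ ∈ (H.conj g).toSubgroup := by
  rw [ClosedSubgroup.mem_conj]
  simpa [mul_assoc] using hx

/-- Anticommuting with a nonsingular X forces trace zero, whereas the trace of g is 2 modulo p². -/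
theorem not_anticommute_of_mem_congruence {X : M₂} (htr : X 1 1 = -X 0 0) (hdet : X.det ≠ 0)
    {g : G₂} (hg : g ∈ padicCongruenceSubgroup 2 p 2) : (g : M₂) * X ≠ -(X * g) := by
  intro h
  have hXX : X * X = -(X.det • (1 : M₂)) := by
    rw [Matrix.sq_eq_trace_smul_sub_det_fin_two, Matrix.trace_fin_two, htr]
    simp
  have h1 : ((g : M₂) * X * X).trace = -((g : M₂) * X * X).trace := by
    conv_lhs => rw [h, neg_mul, Matrix.trace_neg, mul_assoc, Matrix.trace_mul_comm]
  rw [mul_assoc, hXX] at h1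
  simp only [mul_neg, Matrix.mul_smul, mul_one, Matrix.trace_neg, Matrix.trace_smul,
    smul_eq_mul, neg_neg] at h1
  have h2 : 2 * X.det * (g : M₂).trace = 0 := by linear_combination -h1
  have h3 : (g : M₂).trace = 0 :=
    (mul_eq_zero.mp h2).resolve_left (mul_ne_zero two_ne_zero hdet)
  obtain ⟨w, hw⟩ := mem_padicCongruenceSubgroup.mp hg
  apply PadicInt.not_sq_dvd_two (p := p)
  refine ⟨-w.trace, ?_⟩
  rw [hw, Matrix.trace_add, Matrix.trace_smul, Matrix.trace_one] at h3
  simp at h3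
  linear_combination h3

variable (H : ClosedSubgroup (SpecialLinearGroup (Fin 2) ℤ_[p]))

/-- `H` is conjugate to a relatively open subgroup of one of the ambient subgroups. -/
def IsConjRelativelyOpen : Prop :=
  ∃ g : SpecialLinearGroup (Fin 2) ℤ_[p], ∃ E ∈ ambientSubgroups p, ∃ m,
    (H.conj g).toSubgroup ≤ E ∧ E ⊓ padicCongruenceSubgroup 2 p m ≤ (H.conj g).toSubgroup

variable {H}

theorem mul_eq_mul_of_eq_two_smul_sub {x X : M₂} {t : ℤ_[p]} (hX : X = (2 : ℤ_[p]) • x - t • 1)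
    (w : M₂) : X * w = w * X ↔ x * w = w * x := by
  rw [hX, sub_mul, mul_sub, Matrix.smul_mul, Matrix.smul_mul, Matrix.mul_smul, Matrix.mul_smul,
    one_mul, mul_one, sub_left_inj]
  exact (smul_right_injective M₂ (two_ne_zero : (2 : ℤ_[p]) ≠ 0)).eq_iff

/-- The one-dimensional case. If det X = 0, conjugation makes x unipotent upper triangular.
Otherwise conjugation makes X proportional to an integer matrix. For h in H the conjugate of X by h
commutes with X and has the same determinant, so it is ±X and h lies in the signed centralizer. -/
theorem isConjRelativelyOpen_of_commute {x : G₂} (hx : x ∈ H.toSubgroup)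
    (hx2 : x ∈ padicCongruenceSubgroup 2 p 2) (hx1 : x ≠ 1)
    (hcomm : ∀ z ∈ H.toSubgroup, z ∈ padicCongruenceSubgroup 2 p 2 → (x : M₂) * z = z * x) :
    IsConjRelativelyOpen H := by
  -- Twice the trace-zero part of x, which stays integral when p = 2.
  set X : M₂ := (2 : ℤ_[p]) • (x : M₂) - (x : M₂).trace • 1 with hX
  have htr : X 1 1 = -X 0 0 := by
    simp [hX, Matrix.trace_fin_two]; ring
  have h2 : (2 : ℤ_[p]) ≠ 0 := two_ne_zero
  have hX0 : X ≠ 0 := by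
    intro h
    have h00 := congrFun (congrFun h 0) 0
    have h01 := congrFun (congrFun h 0) 1
    have h10 := congrFun (congrFun h 1) 0
    simp [hX, Matrix.trace_fin_two] at h00 h01 h10
    exact hx1 (eq_one_of_scalar hx2 h01 h10 (by linear_combination h00))
  by_cases hdet : X.det = 0
  · obtain ⟨g, e, he, hg⟩ := exists_mul_eq_smul_nilpotent_mul hX0 htr hdet
    have e1 := Matrix.SpecialLinearGroup.conj_mul_coe g x
    set x' : G₂ := g * x * g⁻¹ with hx'
    have e2 : (2 : ℤ_[p]) • (x' : M₂) - (x : M₂).trace • 1 = e • !![0, 1; 0, 0] := by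
      have : ((2 : ℤ_[p]) • (x' : M₂) - (x : M₂).trace • 1) * (g : M₂) =
          (e • !![0, 1; 0, 0]) * (g : M₂) := by
        rw [← hg, hX, sub_mul, mul_sub, Matrix.smul_mul, e1]
        simp
      have h3 := congrArg (· * ((g⁻¹ : G₂) : M₂)) this
      simp only [mul_assoc, ← Matrix.SpecialLinearGroup.coe_mul, mul_inv_cancel,
        Matrix.SpecialLinearGroup.coe_one, mul_one] at h3
      exact h3
    have a00 := congrFun (congrFun e2 0) 0
    have a01 := congrFun (congrFun e2 0) 1
    have a10 := congrFun (congrFun e2 1) 0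
    have a11 := congrFun (congrFun e2 1) 1
    simp at a00 a01 a10 a11
    obtain ⟨h1, m, hm⟩ := le_torsionUpper_and_inf_le (H := H.conj g) (x := x')
      (H.conj_mem_conj g hx) (Subgroup.Normal.conj_mem inferInstance x hx2 g) a10
      (by apply mul_left_cancel₀ h2; linear_combination a00 - a11)
      (by intro h; rw [h, mul_zero] at a01; exact he a01.symm) (by
        intro z hz hz2
        rw [ClosedSubgroup.mem_conj] at hz
        have := hcomm _ hz (by
          simpa using Subgroup.Normal.conj_mem inferInstance z hz2 g⁻¹)
        rw [← Matrix.SpecialLinearGroup.coe_mul, ← Matrix.SpecialLinearGroup.coe_mul] at this ⊢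
        have h4 : x * (g⁻¹ * z * g) = g⁻¹ * z * g * x := Subtype.ext this
        congr 1
        calc x' * z = g * (x * (g⁻¹ * z * g)) * g⁻¹ := by rw [hx']; group
          _ = z * x' := by rw [h4, hx']; group)
    exact ⟨g, _, Or.inl (by simp), m, h1, hm⟩
  · obtain ⟨g, X₀, w, hw, hg⟩ := exists_smul_mul_eq_intCast_mul htr hdet
    obtain ⟨m, hm2, hm⟩ := exists_forall_mem_of_commute hx hx2 hx1 hcomm
    have hinv : (g : M₂) * ((g⁻¹ : G₂) : M₂) = 1 := by
      rw [← Matrix.SpecialLinearGroup.coe_mul, mul_inv_cancel, Matrix.SpecialLinearGroup.coe_one]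
    set X₁ : M₂ := X₀.map (Int.cast : ℤ → ℤ_[p]) with hX₁
    have hN : ∀ z : G₂, z ∈ signedCentralizer X₁ ↔ g⁻¹ * z * g ∈ signedCentralizer X := by
      intro z
      have e1 : ((g : M₂) * ((g⁻¹ * z * g : G₂) : M₂)) = z * g := by
        have : g * (g⁻¹ * z * g) = z * g := by group
        rw [← Matrix.SpecialLinearGroup.coe_mul, this, Matrix.SpecialLinearGroup.coe_mul]
      set z' : G₂ := g⁻¹ * z * g
      have e3 : w • ((g : M₂) * (z' * X)) = (z * X₁) * g := by
        rw [← mul_assoc, e1, mul_assoc, ← Matrix.mul_smul, hg, mul_assoc]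
      have e4 : w • ((g : M₂) * (X * z')) = (X₁ * z) * g := by
        rw [← mul_assoc, ← Matrix.smul_mul, hg, mul_assoc, e1, mul_assoc]
      have inj : Function.Injective fun A : M₂ => A * (g : M₂) := by
        intro A B h
        have := congrArg (· * ((g⁻¹ : G₂) : M₂)) h
        simpa only [mul_assoc, hinv, mul_one] using this
      have inj' : Function.Injective fun A : M₂ => w • ((g : M₂) * A) := by
        intro A B h
        have h3 := smul_right_injective M₂ hw h
        have := congrArg (((g⁻¹ : G₂) : M₂) * ·) h3
        simpa only [← mul_assoc, ← Matrix.SpecialLinearGroup.coe_mul, inv_mul_cancel,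
          Matrix.SpecialLinearGroup.coe_one, one_mul] using this
      have c1 : (z : M₂) * X₁ = X₁ * z ↔ (z' : M₂) * X = X * z' := by
        refine inj.eq_iff.symm.trans (Iff.trans ?_ inj'.eq_iff)
        simp only [e3, e4]
      have c2 : (z : M₂) * X₁ = -(X₁ * z) ↔ (z' : M₂) * X = -(X * z') := by
        refine inj.eq_iff.symm.trans (Iff.trans ?_ inj'.eq_iff)
        simp only [mul_neg, neg_mul, smul_neg, e3, e4]
      exact or_congr c1 c2
    refine ⟨g, signedCentralizer X₁, Or.inr ⟨X₀, rfl⟩, m, ?_, ?_⟩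
    · intro z hz
      rw [hN]
      rw [ClosedSubgroup.mem_conj] at hz
      generalize g⁻¹ * z * g = h at hz
      have hmem : h * x * h⁻¹ ∈ H.toSubgroup := mul_mem (mul_mem hz hx) (inv_mem hz)
      have hc := hcomm _ hmem (Subgroup.Normal.conj_mem inferInstance x hx2 h)
      have e1 := Matrix.SpecialLinearGroup.conj_mul_coe h x
      set x' : M₂ := ((h * x * h⁻¹ : G₂) : M₂) with hx'
      set Y : M₂ := (2 : ℤ_[p]) • x' - (x : M₂).trace • 1 with hY
      have hYh : Y * (h : M₂) = h * X := by
        rw [hY, hX, sub_mul, mul_sub, Matrix.smul_mul, e1]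
        simp
      have hYtr : Y 1 1 = -Y 0 0 := by
        have : x'.trace = (x : M₂).trace := by
          rw [hx', Matrix.SpecialLinearGroup.coe_mul, Matrix.trace_mul_comm,
            ← Matrix.SpecialLinearGroup.coe_mul, ← mul_assoc, inv_mul_cancel, one_mul]
        simp [hY, ← this, Matrix.trace_fin_two]; ring
      have hYdet : X.det = Y.det := by
        have := congrArg Matrix.det hYh
        rw [Matrix.det_mul, Matrix.det_mul, Matrix.SpecialLinearGroup.det_coe] at this
        rw [mul_one, one_mul] at this
        exact this.symm
      have hXY : X * Y = Y * X := by
        rw [mul_eq_mul_of_eq_two_smul_sub hX, eq_comm, mul_eq_mul_of_eq_two_smul_sub hY]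
        exact hc.symm
      rcases Matrix.eq_or_eq_neg_of_commute_of_trace_eq_zero htr hYtr hXY h2 hYdet hdet with h3 | h3
      · left; rw [← hYh, h3]
      · right; rw [← hYh, h3, neg_mul]
    · rintro z ⟨hz, hzm⟩
      rw [ClosedSubgroup.mem_conj]
      have hz' : g⁻¹ * z * g ∈ padicCongruenceSubgroup 2 p m := by
        simpa using Subgroup.Normal.conj_mem inferInstance z hzm g⁻¹
      refine hm _ hz' ?_
      rcases (hN z).mp hz with h3 | h3
      · exact (mul_eq_mul_of_eq_two_smul_sub hX _).mp h3.symm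
      · exact absurd h3 (not_anticommute_of_mem_congruence htr hdet
          (padicCongruenceSubgroup_antitone hm2 hz'))

/-- Put c = xy - yx. A z with tr(cz) ≠ 0 gives three independent trace-zero parts, and H is open. If
there is none, z = xy yields det c = 0. After conjugation c is a multiple of the elementary
nilpotent matrix, and tr(cz) = 0 says that z is upper triangular. -/
theorem isConjRelativelyOpen_of_not_commute {x y : G₂} (hx : x ∈ H.toSubgroup)
    (hy : y ∈ H.toSubgroup)
    (hx2 : x ∈ padicCongruenceSubgroup 2 p 2) (hy2 : y ∈ padicCongruenceSubgroup 2 p 2)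
    (hxy : (x : M₂) * y ≠ y * x) : IsConjRelativelyOpen H := by
  by_cases hz : ∃ z ∈ H.toSubgroup, z ∈ padicCongruenceSubgroup 2 p 2 ∧
      (((x : M₂) * y - y * x) * z).trace ≠ 0
  · obtain ⟨z, hz, hz2, hne⟩ := hz
    obtain ⟨m, hm⟩ := exists_congruence_le_of_trace_ne_zero hx hy hz hx2 hy2 hz2 hne
    refine ⟨1, ⊤, Or.inl (by simp), m, le_top, fun w hw => ?_⟩
    rw [ClosedSubgroup.mem_conj]
    simpa using hm hw.2
  · push Not at hz
    set c : M₂ := (x : M₂) * y - y * x with hc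
    have hc0 : c ≠ 0 := sub_ne_zero.mpr hxy
    have htr : c 1 1 = -c 0 0 := by
      simp [hc, Matrix.mul_apply, Fin.sum_univ_two]; ring
    have hdet : c.det = 0 := by
      have h1 := hz (x * y) (mul_mem hx hy) (mul_mem hx2 hy2)
      rw [Matrix.SpecialLinearGroup.coe_mul] at h1
      have h2 : c.det = -(c * ((x : M₂) * y)).trace := by
        simp only [hc, Matrix.det_fin_two, Matrix.trace_fin_two, Matrix.mul_apply,
          Fin.sum_univ_two, Matrix.sub_apply]
        ring
      rw [h2, h1, neg_zero]
    obtain ⟨g, e, he, hg⟩ := exists_mul_eq_smul_nilpotent_mul hc0 htr hdet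
    obtain ⟨h1, m, hm⟩ := le_upper_and_upper_inf_le (H := H.conj g)
      (H.conj_mem_conj g hx) (H.conj_mem_conj g hy)
      (Subgroup.Normal.conj_mem inferInstance x hx2 g)
      (Subgroup.Normal.conj_mem inferInstance y hy2 g) (by
        intro z hzH hz2
        rw [ClosedSubgroup.mem_conj] at hzH
        have h3 := hz _ hzH (by simpa using Subgroup.Normal.conj_mem inferInstance z hz2 g⁻¹)
        have h4 : (c * ((g⁻¹ * z * g : G₂) : M₂)).trace = e * (z : M₂) 1 0 := by
          rw [Matrix.SpecialLinearGroup.coe_mul, ← mul_assoc, Matrix.trace_mul_comm, ← mul_assoc,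
            hg, Matrix.SpecialLinearGroup.coe_mul, mul_assoc, ← mul_assoc (g : M₂),
            ← Matrix.SpecialLinearGroup.coe_mul, mul_inv_cancel,
            Matrix.SpecialLinearGroup.coe_one, one_mul, Matrix.trace_fin_two]
          simp [Matrix.mul_apply, Fin.sum_univ_two]
        rw [h4] at h3
        exact (mul_eq_zero.mp h3).resolve_left he) (by
        intro h
        apply hxy
        rw [← Matrix.SpecialLinearGroup.coe_mul, ← Matrix.SpecialLinearGroup.coe_mul] at h ⊢
        have h5 : g * x * g⁻¹ * (g * y * g⁻¹) = g * y * g⁻¹ * (g * x * g⁻¹) := Subtype.ext h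
        have h6 : x * y = y * x := by
          calc x * y = g⁻¹ * (g * x * g⁻¹ * (g * y * g⁻¹)) * g := by group
            _ = y * x := by rw [h5]; group
        rw [h6])
    exact ⟨g, _, Or.inl (by simp), m, h1, hm⟩

theorem inf_congruence_eq_bot_or_isConjRelativelyOpen :
    (∀ x ∈ H.toSubgroup, x ∈ padicCongruenceSubgroup 2 p 2 → x = 1) ∨ IsConjRelativelyOpen H := by
  by_contra hcon
  push Not at hcon
  obtain ⟨⟨x, hx, hx2, hx1⟩, h⟩ := hcon
  by_cases hc : ∀ z ∈ H.toSubgroup, z ∈ padicCongruenceSubgroup 2 p 2 → (x : M₂) * z = z * x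
  · exact h (isConjRelativelyOpen_of_commute hx hx2 hx1 hc)
  · push Not at hc
    obtain ⟨y, hy, hy2, hxy⟩ := hc
    exact h (isConjRelativelyOpen_of_not_commute hx hy hx2 hy2 hxy)

end Classification

/-! ### Finite subgroups of SL₂(ℤ_p). -/

section FiniteSubgroups

variable {p : ℕ} [Fact p.Prime]

local notation "M₂" => Matrix (Fin 2) (Fin 2) ℤ_[p]
local notation "G₂" => SpecialLinearGroup (Fin 2) ℤ_[p]

theorem finite_of_inf_eq_bot {G : Type*} [Group G] {H N : Subgroup G} [N.FiniteIndex]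
    (h : ∀ x ∈ H, x ∈ N → x = 1) : Finite H := by
  have : Finite (G ⧸ N) := inferInstance
  refine Finite.of_injective (fun x : H => (QuotientGroup.mk (x : G) : G ⧸ N)) ?_
  intro x y hxy
  have := h _ (mul_mem (inv_mem x.2) y.2) (QuotientGroup.eq.mp hxy)
  exact Subtype.ext (inv_mul_eq_one.mp this)

/-- An isomorphism between finite subgroups which is close to the identity is induced by
conjugation. -/
theorem exists_conj_of_near {H H' : Subgroup G₂} [Finite H] (φ : H →* G₂) {k : ℕ}
    (hk : (Nat.card H : ℤ_[p]) ∣ (p : ℤ_[p]) ^ k)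
    (hφ : ∀ h : H, (h : G₂)⁻¹ * φ h ∈ padicCongruenceSubgroup 2 p (k + 3))
    (hrange : φ.range = H') : ∃ g : G₂, H.map (MulAut.conj g).toMonoidHom = H' := by
  have : Fintype H := Fintype.ofFinite H
  obtain ⟨D, hD⟩ := hk
  have hw : ∀ h : H, ∃ w : M₂, ((φ h * (h : G₂)⁻¹ : G₂) : M₂) = 1 + (p : ℤ_[p]) ^ (k + 3) • w := by
    intro h
    refine mem_padicCongruenceSubgroup.mp ?_
    exact Subgroup.Normal.mem_comm inferInstance (hφ h)
  choose w hw using hw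
  have hcard : (Nat.card H : ℤ_[p]) ≠ 0 := Nat.cast_ne_zero.mpr Nat.card_pos.ne'
  -- The sum T of φ(h)h⁻¹ satisfies Th = φ(h)T. It is |H| plus a multiple of p^(k+3), hence of |H|
  -- p³, so it is a nonzero multiple of an element of SL₂.
  set T : M₂ := ∑ h : H, ((φ h * (h : G₂)⁻¹ : G₂) : M₂) with hT
  obtain ⟨g, c, hc, hg⟩ := exists_eq_smul_of_near_scalar hcard (D • ∑ h : H, w h)
  have hTg : T = c • (g : M₂) := by
    rw [← hg, hT]
    simp only [hw, Finset.sum_add_distrib, ← Finset.smul_sum, Finset.sum_const, Finset.card_univ]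
    rw [smul_smul, Nat.card_eq_fintype_card, ← Nat.cast_smul_eq_nsmul ℤ_[p], pow_add, hD,
      Nat.card_eq_fintype_card]
    congr 2
    ring
  have hcomm : ∀ h : H, g * h = φ h * g := by
    intro h
    have h1 : T * ((h : G₂) : M₂) = (φ h : M₂) * T := by
      rw [hT, Finset.sum_mul, Finset.mul_sum]
      refine Fintype.sum_equiv (Equiv.mulLeft h⁻¹) _ _ fun x => ?_
      rw [← Matrix.SpecialLinearGroup.coe_mul, ← Matrix.SpecialLinearGroup.coe_mul]
      have : φ x * (x : G₂)⁻¹ * h = φ h * (φ (h⁻¹ * x) * ((h⁻¹ * x : H) : G₂)⁻¹) := by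
        rw [map_mul, map_inv, Subgroup.coe_mul, Subgroup.coe_inv]; group
      rw [this]; rfl
    rw [hTg, Matrix.smul_mul, Matrix.mul_smul] at h1
    have h2 := smul_right_injective M₂ hc h1
    exact Subtype.ext h2
  refine ⟨g, ?_⟩
  rw [← hrange]
  ext x
  constructor
  · rintro ⟨h, hh, rfl⟩
    refine ⟨⟨h, hh⟩, ?_⟩
    have := hcomm ⟨h, hh⟩
    simp only at this
    simp [this]
  · rintro ⟨h, rfl⟩
    exact ⟨h, h.2, by simp [hcomm h]⟩

/-- The invariant of a finite H is an exponent k with |H| dividing p^k in ℤ_p, together with its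
image modulo p^(k+3). Groups with the same image are matched element by element; the matching is
multiplicative because H' injects into the quotient, and `exists_conj_of_near` makes it a
conjugation. -/
theorem countable_image_classes_of_inf_eq_bot :
    ((fun H => (⟦H⟧ : ClosedSubgroupClasses G₂)) ''
      {H | ∀ x ∈ H.toSubgroup, x ∈ padicCongruenceSubgroup 2 p 2 → x = 1}).Countable := by
  have (m : ℕ) : Finite (G₂ ⧸ padicCongruenceSubgroup 2 p m) := inferInstance
  refine Set.Countable.image_of_relation (D := Σ m, Set (G₂ ⧸ padicCongruenceSubgroup 2 p (m + 3)))
    _ _ (fun H d => (Nat.card H.toSubgroup : ℤ_[p]) ∣ (p : ℤ_[p]) ^ d.1 ∧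
      QuotientGroup.mk '' H.toSubgroup.carrier = d.2) ?_ ?_
  · intro H hH
    have := finite_of_inf_eq_bot hH
    obtain ⟨k, hk⟩ := PadicInt.exists_dvd_pow (p := p) (x := (Nat.card H.toSubgroup : ℤ_[p]))
      (Nat.cast_ne_zero.mpr Nat.card_pos.ne')
    exact ⟨⟨k, QuotientGroup.mk '' H.toSubgroup.carrier⟩, hk, rfl⟩
  · rintro H hH H' hH' ⟨k, S⟩ ⟨hk, hS⟩ ⟨-, hS'⟩
    have := finite_of_inf_eq_bot hH
    have key : ∀ K K' : ClosedSubgroup G₂, (QuotientGroup.mk '' K.toSubgroup.carrier :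
        Set (G₂ ⧸ padicCongruenceSubgroup 2 p (k + 3))) = QuotientGroup.mk '' K'.toSubgroup.carrier →
        ∀ x ∈ K.toSubgroup, ∃ y ∈ K'.toSubgroup, x⁻¹ * y ∈ padicCongruenceSubgroup 2 p (k + 3) := by
      intro K K' e x hx
      obtain ⟨y, hy, hyx⟩ : (QuotientGroup.mk x : G₂ ⧸ padicCongruenceSubgroup 2 p (k + 3)) ∈
          (QuotientGroup.mk '' K'.toSubgroup.carrier : Set _) := e ▸ ⟨x, hx, rfl⟩
      exact ⟨y, hy, QuotientGroup.eq.mp hyx.symm⟩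
    have huniq : ∀ y ∈ H'.toSubgroup, ∀ z ∈ H'.toSubgroup,
        y⁻¹ * z ∈ padicCongruenceSubgroup 2 p (k + 3) → y = z := by
      intro y hy z hz hyz
      exact inv_mul_eq_one.mp (hH' _ (mul_mem (inv_mem hy) hz)
        (padicCongruenceSubgroup_antitone (by omega) hyz))
    choose f hf hfx using fun x : H.toSubgroup => key H H' (by rw [hS, hS']) x x.2
    have hmk : ∀ x : H.toSubgroup, (QuotientGroup.mk (f x) :
        G₂ ⧸ padicCongruenceSubgroup 2 p (k + 3)) = QuotientGroup.mk (x : G₂) :=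
      fun x => (QuotientGroup.eq.mpr (hfx x)).symm
    let φ : H.toSubgroup →* G₂ := MonoidHom.mk' f (by
      intro x y
      refine huniq _ (hf _) _ (mul_mem (hf x) (hf y)) (QuotientGroup.eq.mp ?_)
      rw [hmk, QuotientGroup.mk_mul, hmk, hmk, Subgroup.coe_mul, QuotientGroup.mk_mul])
    have hrange : φ.range = H'.toSubgroup := by
      ext y
      constructor
      · rintro ⟨x, rfl⟩; exact hf x
      · intro hy
        obtain ⟨x, hx, hxy⟩ := key H' H (by rw [hS, hS']) y hy
        refine ⟨⟨x, hx⟩, (huniq _ hy _ (hf _) (QuotientGroup.eq.mp ?_)).symm⟩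
        rw [hmk]
        exact QuotientGroup.eq.mpr hxy
    exact Quotient.sound (exists_conj_of_near φ hk hfx hrange)

theorem countable_closedSubgroupClasses_fin_two : Countable (ClosedSubgroupClasses G₂) := by
  rw [← Set.countable_univ_iff]
  refine (countable_image_classes_of_inf_eq_bot.union
    (countable_image_classes_of_relatively_open (padicCongruenceSubgroup 2 p) (ambientSubgroups p)
      countable_ambientSubgroups {H | IsConjRelativelyOpen H} fun H hH => hH)).mono ?_
  rintro ⟨H⟩ -
  rcases inf_congruence_eq_bot_or_isConjRelativelyOpen (H := H) with h | h
  · exact Or.inl ⟨H, h, rfl⟩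
  · exact Or.inr ⟨H, h, rfl⟩

end FiniteSubgroups

/-! ### Procyclic diagonal subgroups and the case n ≥ 3. -/

section TorusSubgroups

variable {p : ℕ} [Fact p.Prime] {n : ℕ}

theorem PadicInt.not_countable : ¬ Countable ℤ_[p] := by
  intro h
  have h1 : (Set.range fun x : ℤ_[p] => (x : ℚ_[p])).Countable := Set.countable_range _
  have h2 := h1.dense_compl ℚ_[p]
  obtain ⟨x, hx, hx'⟩ := h2.inter_open_nonempty (Metric.ball 0 1) Metric.isOpen_ball ⟨0, by simp⟩
  exact hx' ⟨⟨x, by simpa using (mem_ball_zero_iff.mp hx).le⟩, rfl⟩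

theorem Matrix.SpecialLinearGroup.continuous_entry (i j : Fin n) :
    Continuous fun g : SpecialLinearGroup (Fin n) ℤ_[p] =>
      (g : Matrix (Fin n) (Fin n) ℤ_[p]) i j := by
  have h : Continuous fun g : SpecialLinearGroup (Fin n) ℤ_[p] =>
      (g : Matrix (Fin n) (Fin n) ℤ_[p]) := continuous_subtype_val
  exact h.matrix_elem i j

theorem mem_padicCongruenceSubgroup_iff_norm {m : ℕ} {g : SpecialLinearGroup (Fin n) ℤ_[p]} :
    g ∈ padicCongruenceSubgroup n p m ↔ ∀ i j, ‖(g : Matrix (Fin n) (Fin n) ℤ_[p]) i j -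
      (1 : Matrix (Fin n) (Fin n) ℤ_[p]) i j‖ ≤ (p : ℝ) ^ (-(m : ℤ)) := by
  simp only [PadicInt.norm_le_pow_iff_mem_span_pow, Ideal.mem_span_singleton]
  rw [mem_padicCongruenceSubgroup]
  constructor
  · rintro ⟨w, hw⟩ i j
    rw [hw]
    simp
  · intro h
    choose w hw using h
    refine ⟨Matrix.of w, ?_⟩
    ext i j
    simp [← hw]

theorem isOpen_padicCongruenceSubgroup (m : ℕ) :
    IsOpen (padicCongruenceSubgroup n p m : Set (SpecialLinearGroup (Fin n) ℤ_[p])) := by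
  refine Subgroup.isOpen_of_isClosed_of_finiteIndex _ ?_
  have : (padicCongruenceSubgroup n p m : Set (SpecialLinearGroup (Fin n) ℤ_[p])) =
      ⋂ i, ⋂ j, {g : SpecialLinearGroup (Fin n) ℤ_[p] | ‖(g : Matrix (Fin n) (Fin n) ℤ_[p]) i j -
      (1 : Matrix (Fin n) (Fin n) ℤ_[p]) i j‖ ≤ (p : ℝ) ^ (-(m : ℤ))} := by
    ext g
    simp only [SetLike.mem_coe, mem_padicCongruenceSubgroup_iff_norm, Set.mem_iInter]
    rfl
  rw [this]
  refine isClosed_iInter fun i => isClosed_iInter fun j => ?_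
  exact isClosed_le ((Matrix.SpecialLinearGroup.continuous_entry i j).sub continuous_const).norm
    continuous_const

/-- The procyclic subgroup topologically generated by `t`. -/
def procyclicSubgroup {G : Type*} [Group G] [TopologicalSpace G] [IsTopologicalGroup G] (t : G) :
    ClosedSubgroup G where
  toSubgroup := (Subgroup.zpowers t).topologicalClosure
  isClosed' := Subgroup.isClosed_topologicalClosure _

/-- Modulo the open subgroup N the closure adds nothing to the powers of t, and since t has finite
order there, natural exponents suffice. -/
theorem exists_pow_inv_mul_mem_of_mem_procyclicSubgroup {G : Type*} [Group G] [TopologicalSpace G]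
    [IsTopologicalGroup G] {t s : G} (hs : s ∈ (procyclicSubgroup t).toSubgroup) (N : Subgroup G)
    [N.Normal] [N.FiniteIndex] (hN : IsOpen (N : Set G)) : ∃ k : ℕ, (t ^ k)⁻¹ * s ∈ N := by
  have hle : (procyclicSubgroup t).toSubgroup ≤ Subgroup.zpowers t ⊔ N :=
    Subgroup.topologicalClosure_minimal _ le_sup_left
      (Subgroup.isClosed_of_isOpen _ (Subgroup.isOpen_mono le_sup_right hN))
  obtain ⟨_, ⟨k, rfl⟩, y, hy, rfl⟩ := Subgroup.mem_sup_of_normal_right.mp (hle hs)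
  have hfin : IsOfFinOrder (QuotientGroup.mk t : G ⧸ N) := isOfFinOrder_of_finite _
  obtain ⟨k', hk'⟩ : (QuotientGroup.mk t : G ⧸ N) ^ k ∈ Submonoid.powers (QuotientGroup.mk t : G ⧸ N) :=
    hfin.mem_powers_iff_mem_zpowers.mpr ⟨k, rfl⟩
  refine ⟨k', QuotientGroup.eq.mp ?_⟩
  rw [QuotientGroup.mk_pow]
  refine Eq.trans hk' ?_
  rw [← QuotientGroup.mk_zpow]
  exact QuotientGroup.eq.mpr (by simpa using hy)

/-- The diagonal matrix with entries `d`. -/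
noncomputable def diagonalSL (d : Fin n → ℤ_[p]) (hd : ∏ i, d i = 1) : SpecialLinearGroup (Fin n) ℤ_[p] :=
  ⟨Matrix.diagonal d, by rw [Matrix.det_diagonal, hd]⟩

theorem coe_diagonalSL_pow (d : Fin n → ℤ_[p]) (hd : ∏ i, d i = 1) (k : ℕ) :
    ((diagonalSL d hd ^ k : SpecialLinearGroup (Fin n) ℤ_[p]) : Matrix (Fin n) (Fin n) ℤ_[p]) =
      Matrix.diagonal fun i => d i ^ k := by
  rw [Matrix.SpecialLinearGroup.coe_pow]
  exact Matrix.diagonal_pow d k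

section Procyclic

variable {d : Fin n → ℤ_[p]} {hd : ∏ i, d i = 1}

theorem exists_eq_diagonal_add {s : SpecialLinearGroup (Fin n) ℤ_[p]}
    (hs : s ∈ (procyclicSubgroup (diagonalSL d hd)).toSubgroup) (m : ℕ) :
    ∃ (k : ℕ) (w : Matrix (Fin n) (Fin n) ℤ_[p]), (s : Matrix (Fin n) (Fin n) ℤ_[p]) =
      Matrix.diagonal (fun i => d i ^ k) + (p : ℤ_[p]) ^ m • w := by
  obtain ⟨k, hk⟩ := exists_pow_inv_mul_mem_of_mem_procyclicSubgroup hs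
    (padicCongruenceSubgroup n p m) (isOpen_padicCongruenceSubgroup m)
  obtain ⟨w, hw⟩ := mem_padicCongruenceSubgroup.mp hk
  refine ⟨k, Matrix.diagonal (fun i => d i ^ k) * w, ?_⟩
  have h : s = diagonalSL d hd ^ k * ((diagonalSL d hd ^ k)⁻¹ * s) := by group
  conv_lhs => rw [h]
  rw [Matrix.SpecialLinearGroup.coe_mul, hw, coe_diagonalSL_pow, mul_add, mul_one, Matrix.mul_smul]

theorem eq_diagonal_of_mem_procyclicSubgroup {s : SpecialLinearGroup (Fin n) ℤ_[p]}
    (hs : s ∈ (procyclicSubgroup (diagonalSL d hd)).toSubgroup) :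
    (s : Matrix (Fin n) (Fin n) ℤ_[p]) =
      Matrix.diagonal fun i => (s : Matrix (Fin n) (Fin n) ℤ_[p]) i i := by
  ext i j
  by_cases hij : i = j
  · simp [hij]
  · rw [Matrix.diagonal_apply_ne _ hij]
    refine PadicInt.eq_zero_of_forall_pow_dvd fun m => ?_
    obtain ⟨k, w, h⟩ := exists_eq_diagonal_add hs m
    rw [h]
    simp [Matrix.diagonal_apply_ne _ hij]

theorem entry_eq_one_of_mem_procyclicSubgroup {s : SpecialLinearGroup (Fin n) ℤ_[p]}
    (hs : s ∈ (procyclicSubgroup (diagonalSL d hd)).toSubgroup) {i : Fin n} (hi : d i = 1) :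
    (s : Matrix (Fin n) (Fin n) ℤ_[p]) i i = 1 := by
  rw [← sub_eq_zero]
  refine PadicInt.eq_zero_of_forall_pow_dvd fun m => ?_
  obtain ⟨k, w, h⟩ := exists_eq_diagonal_add hs m
  rw [h]
  simp [hi]

/-- An element of a procyclic group of diagonal matrices, congruent to `1` modulo `p ^ 2`, is
determined by each of its entries at which the generator is nontrivial. -/
theorem eq_of_mem_procyclicSubgroup_of_entry_eq (hd2 : ∀ i, (p : ℤ_[p]) ^ 2 ∣ d i - 1)
    {s s' : SpecialLinearGroup (Fin n) ℤ_[p]}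
    (hs : s ∈ (procyclicSubgroup (diagonalSL d hd)).toSubgroup)
    (hs' : s' ∈ (procyclicSubgroup (diagonalSL d hd)).toSubgroup) {i : Fin n} (hi : d i ≠ 1)
    (h : (s : Matrix (Fin n) (Fin n) ℤ_[p]) i i = (s' : Matrix (Fin n) (Fin n) ℤ_[p]) i i) :
    s = s' := by
  have key : ∀ z ∈ (procyclicSubgroup (diagonalSL d hd)).toSubgroup,
      (z : Matrix (Fin n) (Fin n) ℤ_[p]) i i = 1 → z = 1 := by
    intro z hz hzi
    obtain ⟨r, hr⟩ := PadicInt.exists_forall_pow_dvd_of_dvd_pow_sub_one (hd2 i) hi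
    have hentry : ∀ a b, (z : Matrix (Fin n) (Fin n) ℤ_[p]) a b =
        (1 : Matrix (Fin n) (Fin n) ℤ_[p]) a b := by
      intro a b
      rw [← sub_eq_zero]
      refine PadicInt.eq_zero_of_forall_pow_dvd fun m => ?_
      -- Modulo p^(r+m), z is the k-th power of the generator. Its i-th entry being 1 forces p^m to
      -- divide k, which makes all its other entries 1 modulo p^m.
      obtain ⟨k, w, hk⟩ := exists_eq_diagonal_add hz (r + m)
      obtain ⟨l, rfl⟩ : p ^ m ∣ k := by
        refine hr m k ⟨-w i i, ?_⟩
        rw [hk] at hzi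
        simp at hzi
        linear_combination hzi
      rw [hk]
      by_cases hab : a = b
      · subst hab
        simp only [Matrix.add_apply, Matrix.diagonal_apply_eq, Matrix.smul_apply, smul_eq_mul,
          Matrix.one_apply_eq, add_sub_right_comm]
        refine dvd_add ?_ (by rw [pow_add, mul_comm _ ((p : ℤ_[p]) ^ m), mul_assoc]; exact dvd_mul_right _ _)
        have h1 : (p : ℤ_[p]) ∣ d a - 1 := (dvd_pow_self _ two_ne_zero).trans (hd2 a)
        have h2 := dvd_sub_pow_of_dvd_sub h1 m
        rw [pow_mul]
        have h3 := sub_one_dvd_pow_sub_one (d a ^ p ^ m) l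
        rw [one_pow] at h2
        exact ((pow_dvd_pow _ (Nat.le_succ m)).trans h2).trans h3
      · simp only [Matrix.add_apply, Matrix.diagonal_apply_ne _ hab, Matrix.smul_apply, smul_eq_mul,
          Matrix.one_apply_ne hab, zero_add, sub_zero]
        rw [pow_add, mul_comm _ ((p : ℤ_[p]) ^ m), mul_assoc]; exact dvd_mul_right _ _
    exact Matrix.SpecialLinearGroup.ext_iff _ _ |>.mpr hentry
  have hmul : (s : Matrix (Fin n) (Fin n) ℤ_[p]) =
      s' * ((s'⁻¹ * s : SpecialLinearGroup (Fin n) ℤ_[p]) : Matrix (Fin n) (Fin n) ℤ_[p]) := by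
    rw [← Matrix.SpecialLinearGroup.coe_mul, mul_inv_cancel_left]
  have hz : s'⁻¹ * s ∈ (procyclicSubgroup (diagonalSL d hd)).toSubgroup :=
    mul_mem (inv_mem hs') hs
  have hs'i : (s' : Matrix (Fin n) (Fin n) ℤ_[p]) i i ≠ 0 := by
    intro h0
    have := Matrix.SpecialLinearGroup.det_coe s'
    rw [eq_diagonal_of_mem_procyclicSubgroup hs', Matrix.det_diagonal] at this
    exact zero_ne_one ((Finset.prod_eq_zero (f := fun i =>
      (s' : Matrix (Fin n) (Fin n) ℤ_[p]) i i) (Finset.mem_univ i) h0).symm.trans this)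
  have h2 : (s : Matrix (Fin n) (Fin n) ℤ_[p]) i i = (s' : Matrix (Fin n) (Fin n) ℤ_[p]) i i *
      ((s'⁻¹ * s : SpecialLinearGroup (Fin n) ℤ_[p]) : Matrix (Fin n) (Fin n) ℤ_[p]) i i := by
    conv_lhs => rw [hmul, eq_diagonal_of_mem_procyclicSubgroup hs', Matrix.diagonal_mul]
  have := key _ hz (mul_left_cancel₀ hs'i (by rw [← h2, h, mul_one]))
  exact (inv_mul_eq_one.mp this).symm

end Procyclic

/-- The entry `d j` is a root of the characteristic polynomial of s, whose roots are the diagonal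
entries of s. -/
theorem exists_entry_eq_of_conj {d : Fin n → ℤ_[p]} {hd : ∏ i, d i = 1}
    {g s : SpecialLinearGroup (Fin n) ℤ_[p]} (hs : s = g * diagonalSL d hd * g⁻¹)
    (hdiag : (s : Matrix (Fin n) (Fin n) ℤ_[p]) =
      Matrix.diagonal fun i => (s : Matrix (Fin n) (Fin n) ℤ_[p]) i i) (j : Fin n) :
    ∃ i, (s : Matrix (Fin n) (Fin n) ℤ_[p]) i i = d j := by
  have hg : ((g : Matrix (Fin n) (Fin n) ℤ_[p])) *
      ((g⁻¹ : SpecialLinearGroup (Fin n) ℤ_[p]) : Matrix (Fin n) (Fin n) ℤ_[p]) = 1 := by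
    rw [← Matrix.SpecialLinearGroup.coe_mul, mul_inv_cancel, Matrix.SpecialLinearGroup.coe_one]
  have h1 : (d j • (1 : Matrix (Fin n) (Fin n) ℤ_[p]) - s) =
      g * (d j • (1 : Matrix (Fin n) (Fin n) ℤ_[p]) - Matrix.diagonal d) *
        ((g⁻¹ : SpecialLinearGroup (Fin n) ℤ_[p]) : Matrix (Fin n) (Fin n) ℤ_[p]) := by
    rw [mul_sub, sub_mul, Matrix.mul_smul, mul_one, Matrix.smul_mul, hg, hs,
      Matrix.SpecialLinearGroup.coe_mul, Matrix.SpecialLinearGroup.coe_mul]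
    rfl
  have h2 := congrArg Matrix.det h1
  rw [Matrix.det_mul, Matrix.det_mul, Matrix.SpecialLinearGroup.det_coe,
    Matrix.SpecialLinearGroup.det_coe, hdiag, ← Matrix.diagonal_one, ← Matrix.diagonal_smul,
    Matrix.diagonal_sub, Matrix.diagonal_sub, Matrix.det_diagonal, Matrix.det_diagonal] at h2
  rw [Finset.prod_eq_zero (Finset.mem_univ j) (by simp : _ = (0 : ℤ_[p])) (f := fun i =>
    (d j • (fun _ : Fin n => (1 : ℤ_[p]))) i - d i), mul_zero, zero_mul] at h2
  obtain ⟨i, -, hi⟩ := Finset.prod_eq_zero_iff.mp h2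
  have hi' : d j - (s : Matrix (Fin n) (Fin n) ℤ_[p]) i i = 0 := by simpa using hi
  exact ⟨i, (sub_eq_zero.mp hi').symm⟩

/-- Generators have entries 1 + p², 1 + p²a and a third one restoring determinant 1. If the groups
of a and b are conjugate, some element of the group of b has entries 1 + p² and 1 + p²a at places i
and j. For fixed (i, j) the first entry determines the element and hence a. So each class contains
only countably many a, while ℤ_p is uncountable. -/
theorem not_countable_closedSubgroupClasses_of_three_le (hn : 3 ≤ n) :
    ¬ Countable (ClosedSubgroupClasses (SpecialLinearGroup (Fin n) ℤ_[p])) := by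
  intro hcount
  let i₀ : Fin n := ⟨0, by omega⟩
  let i₁ : Fin n := ⟨1, by omega⟩
  let i₂ : Fin n := ⟨2, by omega⟩
  have h01 : i₀ ≠ i₁ := by simp [i₀, i₁]
  have h02 : i₀ ≠ i₂ := by simp [i₀, i₂]
  have h12 : i₁ ≠ i₂ := by simp [i₁, i₂]
  set q := (p : ℤ_[p]) with hq
  have hunit : ∀ a : ℤ_[p], ∃ v : ℤ_[p]ˣ, (v : ℤ_[p]) = 1 + q ^ 2 * a := by
    intro a
    have : IsUnit (1 + q ^ 2 * a) := by
      rw [show q ^ 2 * a = q * (q * a) by ring]; exact PadicInt.isUnit_one_add_mul _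
    exact this
  choose v hv using hunit
  let D : ℤ_[p] → Fin n → ℤ_[p]ˣ := fun a =>
    Pi.mulSingle i₀ (v 1) * Pi.mulSingle i₁ (v a) * Pi.mulSingle i₂ (v 1 * v a)⁻¹
  let d : ℤ_[p] → Fin n → ℤ_[p] := fun a i => (D a i : ℤ_[p])
  have hprod : ∀ a, ∏ i, d a i = 1 := by
    intro a
    have : ∏ i, D a i = 1 := by
      simp only [D, Pi.mul_apply, Finset.prod_mul_distrib, Finset.prod_pi_mulSingle',
        Finset.mem_univ, if_true, mul_inv_cancel]
    simp only [d]
    rw [← Units.coe_prod, this, Units.val_one]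
  have hd0 : ∀ a, d a i₀ = v 1 := by
    intro a; simp [d, D, Pi.mulSingle_apply, h01, h02]
  have hd1 : ∀ a, d a i₁ = v a := by
    intro a; simp [d, D, Pi.mulSingle_apply, h01.symm, h12]
  have hd2 : ∀ a i, q ^ 2 ∣ d a i - 1 := by
    intro a i
    rw [← PadicInt.toZModPow_eq_iff]
    obtain ⟨φ, hφ⟩ : ∃ φ : ℤ_[p]ˣ →* (ZMod (p ^ 2))ˣ,
        ∀ u, (φ u : ZMod (p ^ 2)) = PadicInt.toZModPow 2 (u : ℤ_[p]) :=
      ⟨Units.map (PadicInt.toZModPow (p := p) 2).toMonoidHom, fun _ => rfl⟩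
    have hv' : ∀ b, φ (v b) = 1 := by
      intro b
      ext
      rw [hφ, Units.val_one, ← map_one (PadicInt.toZModPow (p := p) 2), PadicInt.toZModPow_eq_iff,
        hv]
      simp [hq]
    have hD : φ (D a i) = 1 := by
      simp only [D, Pi.mul_apply, map_mul, Pi.mulSingle_apply]
      split_ifs <;> simp [hv']
    rw [map_one]
    change PadicInt.toZModPow 2 (D a i : ℤ_[p]) = 1
    rw [← hφ, hD, Units.val_one]
  have hq0 : q ≠ 0 := PadicInt.natCast_self_ne_zero
  have hv1 : (v 1 : ℤ_[p]) ≠ 1 := by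
    rw [hv]; simp [hq0]
  have hvinj : Function.Injective fun a => (v a : ℤ_[p]) := by
    intro a b hab
    simp only [hv] at hab
    exact mul_left_cancel₀ (pow_ne_zero 2 hq0) (add_left_cancel hab)
  let H : ℤ_[p] → ClosedSubgroup (SpecialLinearGroup (Fin n) ℤ_[p]) := fun a =>
    procyclicSubgroup (diagonalSL (d a) (hprod a))
  let F : ℤ_[p] → ClosedSubgroupClasses (SpecialLinearGroup (Fin n) ℤ_[p]) := fun a => ⟦H a⟧
  have hfib : ∀ b, {a | F a = F b}.Countable := by
    intro b
    have hsub : {a | F a = F b} ⊆ ⋃ ij : Fin n × Fin n, {a | ∃ s ∈ (H b).toSubgroup,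
        (s : Matrix (Fin n) (Fin n) ℤ_[p]) ij.1 ij.1 = v 1 ∧
        (s : Matrix (Fin n) (Fin n) ℤ_[p]) ij.2 ij.2 = v a} := by
      intro a ha
      obtain ⟨g, hg⟩ := Quotient.exact (show F a = F b from ha)
      have hs : g * diagonalSL (d a) (hprod a) * g⁻¹ ∈ (H b).toSubgroup := by
        rw [← hg]
        exact ⟨diagonalSL (d a) (hprod a), Subgroup.le_topologicalClosure _
          (Subgroup.mem_zpowers _), rfl⟩
      have hdiag := eq_diagonal_of_mem_procyclicSubgroup hs
      obtain ⟨i, hi⟩ := exists_entry_eq_of_conj rfl hdiag i₀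
      obtain ⟨j, hj⟩ := exists_entry_eq_of_conj rfl hdiag i₁
      exact Set.mem_iUnion.mpr ⟨(i, j), _, hs, hi.trans (hd0 a), hj.trans (hd1 a)⟩
    refine Set.Countable.mono hsub (Set.countable_iUnion fun ij => Set.Subsingleton.countable ?_)
    rintro a ⟨s, hs, hsi, hsj⟩ a' ⟨s', hs', hsi', hsj'⟩
    have hne : d b ij.1 ≠ 1 := by
      intro h
      exact hv1 (hsi.symm.trans (entry_eq_one_of_mem_procyclicSubgroup hs h))
    have := eq_of_mem_procyclicSubgroup_of_entry_eq (hd2 b) hs hs' hne (hsi.trans hsi'.symm)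
    apply hvinj
    simp only
    rw [← hsj, ← hsj', this]
  apply PadicInt.not_countable (p := p)
  rw [← Set.countable_univ_iff]
  have : (Set.univ : Set ℤ_[p]) = ⋃ c : Set.range F, {a | F a = c} := by
    ext a
    simp
  rw [this]
  refine Set.countable_iUnion ?_
  rintro ⟨_, b, rfl⟩
  exact hfib b

theorem countable_closedSubgroupClasses_specialLinearGroup_iff (p : ℕ) [Fact p.Prime] (n : ℕ) :
    Countable (ClosedSubgroupClasses (SpecialLinearGroup (Fin n) ℤ_[p])) ↔ n ≤ 2 := by
  constructor
  · intro h
    by_contra hn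
    exact not_countable_closedSubgroupClasses_of_three_le (by omega) h
  · intro hn
    have hsub : Subsingleton (SpecialLinearGroup (Fin n) ℤ_[p]) →
        Countable (ClosedSubgroupClasses (SpecialLinearGroup (Fin n) ℤ_[p])) := by
      intro _
      have : Subsingleton (ClosedSubgroup (SpecialLinearGroup (Fin n) ℤ_[p])) :=
        ⟨fun H K => by
          ext1
          exact congrArg (fun L : Subgroup _ => L.carrier)
            (Subsingleton.elim H.toSubgroup K.toSubgroup)⟩
      exact Quotient.countable
    interval_cases n
    · exact hsub inferInstance
    · exact hsub inferInstance
    · exact countable_closedSubgroupClasses_fin_two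

end TorusSubgroups

end SpecialLinear

/-! ### Closed subgroups of A × ∏ ℤ_{p_i}. -/

section PadicProducts

variable {ι : Type*} [Fintype ι] {p : ι → ℕ} [∀ i, Fact (p i).Prime]

theorem PadicInt.tendsto_of_pow_dvd_sub {p : ℕ} [Fact p.Prime] {f : ℕ → ℤ_[p]} {x : ℤ_[p]}
    (h : ∀ k, (p : ℤ_[p]) ^ k ∣ f k - x) : Filter.Tendsto f Filter.atTop (nhds x) := by
  rw [tendsto_iff_norm_sub_tendsto_zero]
  have hp : (1 : ℝ) < p := by exact_mod_cast (Fact.out : p.Prime).one_lt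
  refine squeeze_zero (fun _ => norm_nonneg _) (g := fun k : ℕ => ((p : ℝ)⁻¹) ^ k) (fun k => ?_)
    (tendsto_pow_atTop_nhds_zero_of_lt_one (by positivity) (inv_lt_one_of_one_lt₀ hp))
  have h3 : ‖f k - x‖ ≤ (p : ℝ) ^ (-(k : ℤ)) := by
    rw [PadicInt.norm_le_pow_iff_mem_span_pow, Ideal.mem_span_singleton]
    exact h k
  simpa using h3

theorem PadicInt.pow_dvd_natCast_sub_natCast {p : ℕ} [Fact p.Prime] {k a b : ℕ}
    (h : a ≡ b [MOD p ^ k]) : (p : ℤ_[p]) ^ k ∣ (a : ℤ_[p]) - b := by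
  have h1 : ((p ^ k : ℕ) : ℤ) ∣ (a : ℤ) - b := (Nat.modEq_iff_dvd.mp h.symm)
  have := (PadicInt.pow_p_dvd_int_iff (p := p) k ((a : ℤ) - b)).mpr (by exact_mod_cast h1)
  exact_mod_cast this

/-- Simultaneous approximation of elements of `∏ ℤ_{p_i}`, for distinct primes `p_i`. -/
theorem exists_natCast_approx (hp : Function.Injective p) (x : ∀ i, ℤ_[p i]) (k : ℕ) :
    ∃ N : ℕ, ∀ i, (p i : ℤ_[p i]) ^ k ∣ (N : ℤ_[p i]) - x i := by
  obtain ⟨N, hN⟩ := Nat.chineseRemainderOfFinset (fun i => (x i).appr k) (fun i => p i ^ k)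
    Finset.univ (fun i _ => pow_ne_zero _ (Fact.out : (p i).Prime).ne_zero) (by
      intro i _ j _ hij
      exact Nat.Coprime.pow _ _ ((Nat.coprime_primes Fact.out Fact.out).mpr (hp.ne hij)))
  refine ⟨N, fun i => ?_⟩
  have h1 := PadicInt.pow_dvd_natCast_sub_natCast (hN i (Finset.mem_univ i))
  have h2 := Ideal.mem_span_singleton.mp (PadicInt.appr_spec k (x i))
  have := dvd_sub h1 h2
  have e : (N : ℤ_[p i]) - x i = ((N : ℤ_[p i]) - ((x i).appr k : ℕ)) - (x i - ((x i).appr k : ℕ)) := by ring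
  rw [e]
  exact this

theorem exists_tendsto_natCast (hp : Function.Injective p) (x : ∀ i, ℤ_[p i]) :
    ∃ N : ℕ → ℕ, Filter.Tendsto (fun k => ((N k : ℕ) : ∀ i, ℤ_[p i])) Filter.atTop (nhds x) := by
  choose N hN using exists_natCast_approx hp x
  refine ⟨N, tendsto_pi_nhds.mpr fun i => ?_⟩
  exact PadicInt.tendsto_of_pow_dvd_sub fun k => hN k i

variable {G : Type*} [AddCommGroup G] [TopologicalSpace G]

/-- The preimage of a closed subgroup under a continuous homomorphism `∏ ℤ_{p_i} → G` is an
ideal. -/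
theorem map_mul_mem_of_isClosed (hp : Function.Injective p) (f : (∀ i, ℤ_[p i]) →+ G)
    (hf : Continuous f) {H : AddSubgroup G} (hH : IsClosed (H : Set G)) (c : ∀ i, ℤ_[p i])
    {x : ∀ i, ℤ_[p i]} (hx : f x ∈ H) : f (c * x) ∈ H := by
  obtain ⟨N, hN⟩ := exists_tendsto_natCast hp c
  have h : Filter.Tendsto (fun k => f ((N k : ∀ i, ℤ_[p i]) * x)) Filter.atTop
      (nhds (f (c * x))) := (hf.tendsto _).comp (hN.mul_const x)
  refine hH.mem_of_tendsto h (Filter.Eventually.of_forall fun k => ?_)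
  rw [← nsmul_eq_mul, map_nsmul]
  exact H.nsmul_mem hx _

/-- The preimage of H is an ideal of a finite product ring, so it splits along the coordinate
idempotents. -/
theorem map_mem_iff_forall_single_mem [DecidableEq ι] (hp : Function.Injective p)
    (f : (∀ i, ℤ_[p i]) →+ G)
    (hf : Continuous f) {H : AddSubgroup G} (hH : IsClosed (H : Set G)) {x : ∀ i, ℤ_[p i]} :
    f x ∈ H ↔ ∀ i, f (Pi.single i (x i)) ∈ H := by
  constructor
  · intro h i
    have := map_mul_mem_of_isClosed hp f hf hH (Pi.single i 1) h
    convert this using 2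
    ext j
    by_cases hij : j = i
    · subst hij; simp
    · simp [hij]
  · intro h
    rw [← Finset.univ_sum_single x, map_sum]
    exact sum_mem fun i _ => h i

theorem map_single_mul_mem [DecidableEq ι] (hp : Function.Injective p) (f : (∀ i, ℤ_[p i]) →+ G)
    (hf : Continuous f) {H : AddSubgroup G} (hH : IsClosed (H : Set G)) {i : ι} (c x : ℤ_[p i])
    (h : f (Pi.single i x) ∈ H) : f (Pi.single i (c * x)) ∈ H := by
  have := map_mul_mem_of_isClosed hp f hf hH (Pi.single i c) h
  rwa [← Pi.single_mul] at this

/-- For each i, either H meets the i-th factor trivially or it contains some p_i^m in that factor.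
These exponents, with the image of H modulo the corresponding powers, determine H. -/
theorem countable_closedAddSubgroup_prod {A : Type*} [AddCommGroup A] [TopologicalSpace A]
    [Finite A] (hp : Function.Injective p) :
    Countable {H : AddSubgroup (A × ∀ i, ℤ_[p i]) // IsClosed (H : Set (A × ∀ i, ℤ_[p i]))} := by
  classical
  let f : (∀ i, ℤ_[p i]) →+ A × (∀ i, ℤ_[p i]) := AddMonoidHom.inr A _
  have hf : Continuous f := by
    show Continuous fun x => ((0 : A), x)
    fun_prop
  -- For `none` the default exponent 0 gives modulus 1, so that coordinate is forgotten; `hzero`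
  -- shows that it vanishes on H anyway.
  let red : ∀ k : ι → Option ℕ, A × (∀ i, ℤ_[p i]) → A × ∀ i, ZMod (p i ^ (k i).getD 0) :=
    fun k ax => (ax.1, fun i => PadicInt.toZModPow _ (ax.2 i))
  have : ∀ (k : ι → Option ℕ) (i : ι), NeZero (p i ^ (k i).getD 0) :=
    fun k i => ⟨pow_ne_zero _ (Fact.out : (p i).Prime).ne_zero⟩
  have hcard : 0 < Nat.card A := Nat.card_pos
  have hS : (id '' (Set.univ : Set {H : AddSubgroup (A × ∀ i, ℤ_[p i]) //
      IsClosed (H : Set (A × ∀ i, ℤ_[p i]))})).Countable := by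
    refine Set.Countable.image_of_relation
      (D := Σ k : ι → Option ℕ, Set (A × ∀ i, ZMod (p i ^ (k i).getD 0))) _ _
      (fun H d => (∀ i, d.1 i = none → ∀ x, f (Pi.single i x) ∈ H.1 → x = 0) ∧
        (∀ i m, d.1 i = some m → f (Pi.single i ((p i : ℤ_[p i]) ^ m)) ∈ H.1) ∧
        red d.1 '' (H.1 : Set (A × ∀ i, ℤ_[p i])) = d.2) ?_ ?_
    · rintro ⟨H, hH⟩ -
      have : ∀ i, ∃ o : Option ℕ, (o = none → ∀ x, f (Pi.single i x) ∈ H → x = 0) ∧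
          (∀ m, o = some m → f (Pi.single i ((p i : ℤ_[p i]) ^ m)) ∈ H) := by
        intro i
        by_cases h : ∀ x, f (Pi.single i x) ∈ H → x = 0
        · exact ⟨none, fun _ => h, by simp⟩
        · push Not at h
          obtain ⟨x, hx, hx0⟩ := h
          obtain ⟨m, c, hm⟩ := PadicInt.exists_dvd_pow hx0
          refine ⟨some m, by simp, fun m' hm' => ?_⟩
          obtain rfl := Option.some_injective _ hm'
          rw [hm, mul_comm]
          exact map_single_mul_mem hp f hf hH c x hx
      choose k hk hk' using this
      exact ⟨⟨k, red k '' (H : Set (A × ∀ i, ℤ_[p i]))⟩, hk, hk', rfl⟩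
    · have key : ∀ H H' : {H : AddSubgroup (A × ∀ i, ℤ_[p i]) //
          IsClosed (H : Set (A × ∀ i, ℤ_[p i]))}, ∀ k : ι → Option ℕ,
          (∀ i, k i = none → ∀ x, f (Pi.single i x) ∈ H.1 → x = 0) →
          (∀ i, k i = none → ∀ x, f (Pi.single i x) ∈ H'.1 → x = 0) →
          (∀ i m, k i = some m → f (Pi.single i ((p i : ℤ_[p i]) ^ m)) ∈ H'.1) →
          red k '' (H.1 : Set (A × ∀ i, ℤ_[p i])) = red k '' (H'.1 : Set (A × ∀ i, ℤ_[p i])) →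
          H.1 ≤ H'.1 := by
        rintro ⟨H, hH⟩ ⟨H', hH'⟩ k h1 h2 h3 h4 ⟨a, x⟩ hx
        obtain ⟨⟨a', x'⟩, hx', e⟩ : red k (a, x) ∈ red k '' (H' : Set (A × ∀ i, ℤ_[p i])) :=
          h4 ▸ ⟨_, hx, rfl⟩
        obtain rfl : a' = a := congrArg Prod.fst e
        have e2 : ∀ i, PadicInt.toZModPow ((k i).getD 0) (x' i) = PadicInt.toZModPow _ (x i) :=
          fun i => congrFun (congrArg Prod.snd e) i
        -- Multiplication by |A| kills the A-component, so |A| y i lies in the trivial intersection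
        -- of K with the i-th factor.
        have hzero : ∀ (K : AddSubgroup (A × ∀ i, ℤ_[p i])), IsClosed (K : Set (A × ∀ i, ℤ_[p i])) →
            ∀ y, (a', y) ∈ K → ∀ i, (∀ x, f (Pi.single i x) ∈ K → x = 0) → y i = 0 := by
          intro K hK y hy i hi
          have h5 : f (Nat.card A • y) ∈ K := by
            have := K.nsmul_mem hy (Nat.card A)
            rw [Prod.smul_mk, card_nsmul_eq_zero'] at this
            exact this
          have h6 := hi _ ((map_mem_iff_forall_single_mem hp f hf hK).mp h5 i)
          rw [Pi.smul_apply, nsmul_eq_mul] at h6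
          exact (mul_eq_zero.mp h6).resolve_left (Nat.cast_ne_zero.mpr hcard.ne')
        have h5 : f (x - x') ∈ H' := by
          rw [map_mem_iff_forall_single_mem hp f hf hH']
          intro i
          rcases hki : k i with _ | m
          · rw [Pi.sub_apply, hzero H hH x hx i (h1 i hki), hzero H' hH' x' hx' i (h2 i hki)]
            simp
          · have := e2 i
            rw [hki, Option.getD_some, eq_comm, PadicInt.toZModPow_eq_iff] at this
            obtain ⟨c, hc⟩ := this
            rw [Pi.sub_apply, hc, mul_comm]
            exact map_single_mul_mem hp f hf hH' c _ (h3 i m hki)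
        have h6 := H'.add_mem hx' h5
        simpa [f] using h6
      rintro H - H' - ⟨k, S⟩ ⟨a1, a2, a3⟩ ⟨b1, b2, b3⟩
      exact Subtype.ext (le_antisymm (key H H' k a1 b1 b2 (by rw [a3, b3]))
        (key H' H k b1 a1 a2 (by rw [a3, b3])))
  rw [Set.image_id] at hS
  exact Set.countable_univ_iff.mp hS

end PadicProducts

/-! ### Open monogenic subgroups and their primes. -/

section MonogenicSubgroups

variable {G : Type*} [AddCommGroup G] [TopologicalSpace G] [IsTopologicalAddGroup G]

/-- A compact Hausdorff abelian group with countably many closed subgroups has an open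
topologically monogenic subgroup. -/
theorem exists_isOpen_closure_zmultiples [CompactSpace G] [T2Space G]
    [hc : Countable {H : AddSubgroup G // IsClosed (H : Set G)}] :
    ∃ g : G, IsOpen ((AddSubgroup.zmultiples g).topologicalClosure : Set G) := by
  -- The covering is indexed by the subgroups closure(ℤg), not by the generators g, so that it is
  -- countable and Baire category applies.
  let S := {H : {H : AddSubgroup G // IsClosed (H : Set G)} //
    ∃ g : G, H.1 = (AddSubgroup.zmultiples g).topologicalClosure}
  have h := nonempty_interior_of_iUnion_of_closed (f := fun H : S => (H.1.1 : Set G))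
    (fun H => H.1.2) (by
      refine Set.eq_univ_of_forall fun g => Set.mem_iUnion.mpr ?_
      exact ⟨⟨⟨_, AddSubgroup.isClosed_topologicalClosure _⟩, g, rfl⟩,
        AddSubgroup.le_topologicalClosure _ (AddSubgroup.mem_zmultiples g)⟩)
  obtain ⟨⟨⟨H, hH⟩, g, hg⟩, x, hx⟩ := h
  refine ⟨g, ?_⟩
  rw [← hg]
  exact AddSubgroup.isOpen_of_mem_nhds _ (mem_interior_iff_mem_nhds.mp hx)

/-- The primes that divide the index of an open subgroup of the closure of `ℤ g`. -/
def supportPrimes (g : G) : Set ℕ :=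
  {q | q.Prime ∧ ∃ U : AddSubgroup G, IsOpen (U : Set G) ∧ q • g ∈ U ∧ g ∉ U}

/-- To a set T of support primes attach the intersection of the U_t, t ∈ T. For q ∉ T it is not
contained in U_q: by compactness finitely many t matter, and their product times g lies in those U_t
but, being a multiple of g coprime to q, not in U_q. Hence T can be recovered, and an infinite set
of primes would give uncountably many closed subgroups. -/
theorem finite_supportPrimes [CompactSpace G]
    [hc : Countable {H : AddSubgroup G // IsClosed (H : Set G)}] (g : G) :
    (supportPrimes g).Finite := by
  by_contra hinf
  have hinf' : Infinite (supportPrimes g) := Set.infinite_coe_iff.mpr hinf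
  choose hq U hU hqU hgU using fun q : supportPrimes g => q.2
  have hcl : ∀ q, IsClosed (U q : Set G) := fun q => AddSubgroup.isClosed_of_isOpen _ (hU q)
  let F : Set (supportPrimes g) → {H : AddSubgroup G // IsClosed (H : Set G)} := fun T =>
    ⟨⨅ t : T, U t, by
      rw [AddSubgroup.coe_iInf]
      exact isClosed_iInter fun t => hcl t⟩
  have key : ∀ (T : Set (supportPrimes g)) (q), q ∉ T → ¬ (F T).1 ≤ U q := by
    intro T q hqT hle
    have hne : ((U q : Set G)ᶜ ∩ ⋂ t : T, (U t : Set G)).Nonempty := by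
      refine IsCompact.inter_iInter_nonempty ((hU q).isClosed_compl.isCompact) _
        (fun t => hcl t) fun u => ?_
      refine ⟨(∏ t ∈ u, (t.1.1 : ℕ)) • g, ?_, ?_⟩
      · intro hmem
        have hcop : Nat.Coprime (∏ t ∈ u, (t.1.1 : ℕ)) q.1 := by
          refine Nat.Coprime.prod_left fun t _ => ?_
          refine (Nat.coprime_primes (hq t.1) (hq q)).mpr fun h => hqT ?_
          rw [← Subtype.ext h]
          exact t.2
        obtain ⟨a, b, hab⟩ := (Nat.isCoprime_iff_coprime.mpr hcop)
        refine hgU q ?_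
        have e : g = a • ((∏ t ∈ u, (t.1.1 : ℕ)) • g) + b • (q.1 • g) := by
          rw [← natCast_zsmul g, ← natCast_zsmul g, smul_smul, smul_smul, ← add_smul, hab, one_smul]
        rw [e]
        exact add_mem ((U q).zsmul_mem hmem a) ((U q).zsmul_mem (hqU q) b)
      · refine Set.mem_iInter₂.mpr fun t ht => ?_
        rw [← Finset.prod_erase_mul _ _ ht, mul_smul]
        exact (U t).nsmul_mem (hqU t) _
    obtain ⟨x, hx, hx'⟩ := hne
    refine hx (hle ?_)
    rw [← SetLike.mem_coe, AddSubgroup.coe_iInf]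
    exact hx'
  have hF : Function.Injective F := by
    have hsub : ∀ T T', F T = F T' → T' ⊆ T := by
      intro T T' h q hq'
      by_contra hqT
      refine key T q hqT ?_
      rw [h]
      exact iInf_le (fun t : T' => U t) ⟨q, hq'⟩
    exact fun T T' h => Set.Subset.antisymm (hsub _ _ h.symm) (hsub _ _ h)
  have : Countable (Set (supportPrimes g)) := hF.countable
  have h2 : Countable (Set ℕ) :=
    (Set.image_injective.mpr (Infinite.natEmbedding (supportPrimes g)).injective).countable
  obtain ⟨f, hf⟩ := h2
  exact Function.cantor_injective f hf

/-- A power of the product of the support primes of `g` moves `g` into a given open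
subgroup. -/
theorem exists_prod_pow_smul_mem [CompactSpace G] (g : G) (s : Finset ℕ)
    (hs : ∀ q, q ∈ supportPrimes g → q ∈ s) (U : AddSubgroup G) (hU : IsOpen (U : Set G)) :
    ∃ k : ℕ, ((∏ q ∈ s, q) ^ k) • g ∈ U := by
  have : Finite (G ⧸ U) := AddSubgroup.quotient_finite_of_isOpen U hU
  set m := addOrderOf (QuotientAddGroup.mk g : G ⧸ U) with hm
  have hm0 : m ≠ 0 := (addOrderOf_pos _).ne'
  have hmem : ∀ n : ℤ, n • g ∈ U ↔ (m : ℤ) ∣ n := by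
    intro n
    rw [hm, addOrderOf_dvd_iff_zsmul_eq_zero, ← QuotientAddGroup.mk_zsmul,
      QuotientAddGroup.eq_zero_iff]
  -- A prime dividing the order of g modulo U is a support prime, as witnessed by U + ℤ(qg).
  have hdvd : ∀ q : ℕ, q.Prime → q ∣ m → q ∈ s := by
    intro q hq hqm
    refine hs q ⟨hq, U ⊔ AddSubgroup.zmultiples (q • g), ?_, ?_, ?_⟩
    · exact AddSubgroup.isOpen_mono le_sup_left hU
    · exact (le_sup_right : _ ≤ U ⊔ _) (AddSubgroup.mem_zmultiples _)
    · intro h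
      obtain ⟨u, hu, v, hv, huv⟩ := AddSubgroup.mem_sup.mp h
      obtain ⟨n, rfl⟩ := AddSubgroup.mem_zmultiples_iff.mp hv
      have h1 : (1 - n * q) • g ∈ U := by
        have : (1 - n * q) • g = u := by
          rw [sub_smul, one_smul, mul_smul, natCast_zsmul]
          exact sub_eq_of_eq_add huv.symm
        rwa [this]
      have h2 : (q : ℤ) ∣ 1 - n * q := (Int.natCast_dvd_natCast.mpr hqm).trans ((hmem _).mp h1)
      have h3 : (q : ℤ) ∣ 1 := by
        have := dvd_add h2 (dvd_mul_left (q : ℤ) n)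
        simpa using this
      exact hq.one_lt.ne' (by exact_mod_cast Int.natCast_dvd_natCast.mp (by exact_mod_cast h3) |> Nat.dvd_one.mp)
  have hdvd' : ∀ m : ℕ, m ≠ 0 → (∀ q : ℕ, q.Prime → q ∣ m → q ∈ s) →
      ∃ k, m ∣ (∏ q ∈ s, q) ^ k := by
    intro m
    induction m using Nat.recOnMul with
    | zero => simp
    | one => exact fun _ _ => ⟨0, by simp⟩
    | prime q hq => exact fun _ h => ⟨1, by simpa using Finset.dvd_prod_of_mem _ (h q hq dvd_rfl)⟩
    | mul a b ha hb =>
      intro h0 h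
      obtain ⟨k, hk⟩ := ha (left_ne_zero_of_mul h0) fun q hq hqa => h q hq (hqa.mul_right b)
      obtain ⟨l, hl⟩ := hb (right_ne_zero_of_mul h0) fun q hq hqb => h q hq (hqb.mul_left a)
      exact ⟨k + l, by rw [pow_add]; exact mul_dvd_mul hk hl⟩
  obtain ⟨k, hk⟩ := hdvd' m hm0 hdvd
  refine ⟨k, ?_⟩
  rw [← natCast_zsmul]
  exact (hmem _).mpr (Int.natCast_dvd_natCast.mpr hk)

end MonogenicSubgroups

/-! ### Extending n ↦ ng to a product of ℤ_{p_i}. -/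

section PadicHoms

variable {ι : Type*} [Fintype ι] {p : ι → ℕ} [∀ i, Fact (p i).Prime]
variable {G : Type*} [AddCommGroup G] [TopologicalSpace G] [IsTopologicalAddGroup G]

theorem eventually_forall_pow_dvd (k : ℕ) :
    ∀ᶠ x : ∀ i, ℤ_[p i] in nhds 0, ∀ i, (p i : ℤ_[p i]) ^ k ∣ x i := by
  refine Filter.eventually_all.mpr fun i => ?_
  have hcont : Continuous fun x : ∀ i, ℤ_[p i] => ‖x i‖ := by fun_prop
  have hpos : (0 : ℝ) < (p i : ℝ) ^ (-(k : ℤ)) :=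
    zpow_pos (by exact_mod_cast (Fact.out : (p i).Prime).pos) _
  filter_upwards [(hcont.tendsto 0).eventually_lt_const (u := (p i : ℝ) ^ (-(k : ℤ)))
    (by rw [Pi.zero_apply, norm_zero]; exact hpos)] with x hx
  exact Ideal.mem_span_singleton.mp ((PadicInt.norm_le_pow_iff_mem_span_pow _ _).mp hx.le)

theorem exists_isOpen_notMem [CompactSpace G] [T2Space G] [TotallyDisconnectedSpace G] {c : G}
    (hc : c ≠ 0) : ∃ U : AddSubgroup G, IsOpen (U : Set G) ∧ c ∉ U := by
  obtain ⟨U, hU⟩ := ProfiniteGrp.exist_openNormalAddSubgroup_sub_open_nhds_of_zero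
    (U := {c}ᶜ) (isOpen_compl_singleton) (by simpa using hc.symm)
  exact ⟨U.toAddSubgroup, U.isOpen', fun h => hU h rfl⟩

/-- The homomorphism `ℤ → G`, `n ↦ n g`, extends continuously to `∏ ℤ_{p_i}` as soon as
`(∏ p_i) ^ k g → 0`. -/
theorem exists_continuous_addHom_map_one [CompactSpace G] [T2Space G] [TotallyDisconnectedSpace G]
    (hp : Function.Injective p) (g : G)
    (hg : ∀ U : AddSubgroup G, IsOpen (U : Set G) → ∃ k : ℕ, ((∏ i, p i) ^ k) • g ∈ U) :
    ∃ s : (∀ i, ℤ_[p i]) →+ G, Continuous s ∧ s 1 = g := by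
  -- The closure of ℤ(g, 1) will be the graph of the extension. Its projection to ∏ ℤ_{p_i} is onto
  -- by density and compactness and injective by `hg`, hence a homeomorphism.
  set Δ : AddSubgroup (G × ∀ i, ℤ_[p i]) :=
    (AddSubgroup.zmultiples ((g, 1) : G × ∀ i, ℤ_[p i])).topologicalClosure with hΔ
  have hΔc : IsClosed (Δ : Set (G × ∀ i, ℤ_[p i])) := AddSubgroup.isClosed_topologicalClosure _
  have hgΔ : ((g, 1) : G × ∀ i, ℤ_[p i]) ∈ Δ :=
    AddSubgroup.le_topologicalClosure _ (AddSubgroup.mem_zmultiples _)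
  let π : Δ →+ (∀ i, ℤ_[p i]) := (AddMonoidHom.snd G _).comp Δ.subtype
  have hπ : Continuous π := continuous_snd.comp continuous_subtype_val
  have hΔcomp : CompactSpace Δ := isCompact_iff_compactSpace.mp hΔc.isCompact
  have hinj : Function.Injective π := by
    rw [injective_iff_map_eq_zero]
    rintro ⟨⟨c, y⟩, hcy⟩ (rfl : y = 0)
    by_contra hne
    have hc : c ≠ 0 := fun h => hne (by subst h; rfl)
    obtain ⟨U, hU, hcU⟩ := exists_isOpen_notMem hc
    obtain ⟨k, hk⟩ := hg U hU
    -- a neighbourhood of `(c, 0)` that misses the multiples of `(g, 1)`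
    let W : Set (G × ∀ i, ℤ_[p i]) :=
      {z | z.1 - c ∈ U ∧ ∀ i, (p i : ℤ_[p i]) ^ k ∣ z.2 i}
    have hW : W ∈ nhds ((c, 0) : G × ∀ i, ℤ_[p i]) := by
      have h1 : ∀ᶠ z in nhds ((c, 0) : G × ∀ i, ℤ_[p i]), z.1 - c ∈ U := by
        have hcont : Continuous fun z : G × (∀ i, ℤ_[p i]) => z.1 - c := by fun_prop
        exact hcont.continuousAt.eventually_mem (hU.mem_nhds (by simp))
      have h2 : ∀ᶠ z in nhds ((c, 0) : G × ∀ i, ℤ_[p i]), ∀ i, (p i : ℤ_[p i]) ^ k ∣ z.2 i :=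
        (continuous_snd.tendsto (c, 0)).eventually (eventually_forall_pow_dvd k)
      exact h1.and h2
    obtain ⟨z, hzW, hz⟩ := mem_closure_iff_nhds.mp (show _ ∈ closure _ from hcy) W hW
    obtain ⟨n, rfl⟩ := AddSubgroup.mem_zmultiples_iff.mp hz
    obtain ⟨h1, h2⟩ := hzW
    have h3 : ∀ i, ((p i : ℤ) ^ k) ∣ n := fun i => by
      have := h2 i
      simp only [Prod.smul_mk, zsmul_one] at this
      exact (PadicInt.pow_p_dvd_int_iff k n).mp this
    have h4 : ((∏ i, (p i : ℤ)) ^ k) ∣ n := by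
      rw [← Finset.prod_pow]
      refine Finset.prod_dvd_of_coprime (fun i _ j _ hij => ?_) fun i _ => h3 i
      exact IsCoprime.pow (Nat.isCoprime_iff_coprime.mpr
        ((Nat.coprime_primes Fact.out Fact.out).mpr (hp.ne hij)))
    obtain ⟨m, rfl⟩ := h4
    refine hcU ?_
    have h5 : ((∏ i, (p i : ℤ)) ^ k * m) • g ∈ U := by
      rw [mul_comm, mul_smul]
      refine U.zsmul_mem ?_ m
      rw [← natCast_zsmul] at hk
      exact_mod_cast hk
    have := sub_mem h5 h1
    simpa using this
  have hsurj : Function.Surjective π := by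
    intro x
    obtain ⟨N, hN⟩ := exists_tendsto_natCast hp x
    have hcl : IsClosed (Set.range π) := (isCompact_range hπ).isClosed
    refine hcl.mem_of_tendsto hN (Filter.Eventually.of_forall fun k => ?_)
    exact ⟨N k • ⟨_, hgΔ⟩, by simp [π]⟩
  let e : Δ ≃ (∀ i, ℤ_[p i]) := Equiv.ofBijective π ⟨hinj, hsurj⟩
  have he : Continuous e := hπ
  let E := Continuous.homeoOfEquivCompactToT2 he
  have hE : ∀ x, π (E.symm x) = x := E.apply_symm_apply
  refine ⟨⟨⟨fun x => (E.symm x).1.1, ?_⟩, ?_⟩, ?_, ?_⟩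
  · have : E.symm 0 = 0 := hinj (by rw [hE, map_zero])
    simp [this]
  · intro x y
    have : E.symm (x + y) = E.symm x + E.symm y := hinj (by rw [hE, π.map_add, hE, hE])
    simp [this]
  · exact continuous_fst.comp (continuous_subtype_val.comp E.symm.continuous)
  · have : E.symm 1 = ⟨_, hgΔ⟩ := hinj (by rw [hE]; rfl)
    simp [this]

end PadicHoms

/-! ### Splitting off the p-adic factors. -/

section PadicSplitting

variable {ι : Type*} [Fintype ι] {p : ι → ℕ} [∀ i, Fact (p i).Prime]
variable {G : Type*} [AddCommGroup G] [TopologicalSpace G]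

theorem addHom_eq_of_map_one_eq [T2Space G] (hp : Function.Injective p)
    {f f' : (∀ i, ℤ_[p i]) →+ G} (hf : Continuous f) (hf' : Continuous f') (h : f 1 = f' 1) :
    f = f' := by
  ext1 x
  obtain ⟨N, hN⟩ := exists_tendsto_natCast hp x
  refine tendsto_nhds_unique ((hf.tendsto x).comp hN) (((hf'.tendsto x).comp hN).congr fun k => ?_)
  have e : ((N k : ℕ) : ∀ i, ℤ_[p i]) = N k • 1 := by simp
  simp only [Function.comp_apply]
  rw [e, map_nsmul, map_nsmul, h]

theorem tendsto_prod_pow_mul (x : ∀ i, ℤ_[p i]) :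
    Filter.Tendsto (fun k => (((∏ i, p i) ^ k : ℕ) : ∀ i, ℤ_[p i]) * x) Filter.atTop (nhds 0) := by
  refine tendsto_pi_nhds.mpr fun i => PadicInt.tendsto_of_pow_dvd_sub fun k => ?_
  have h : (p i : ℤ_[p i]) ^ k ∣ (((∏ i, p i) ^ k : ℕ) : ℤ_[p i]) := by
    exact_mod_cast Nat.cast_dvd_cast (pow_dvd_pow_of_dvd
      (Finset.dvd_prod_of_mem p (Finset.mem_univ i)) k)
  simpa using h.mul_right (x i)

theorem exists_mul_eq_dvd_prod_pow (n : ℕ) (hn : n ≠ 0) :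
    ∃ a b k : ℕ, n = a * b ∧ (∀ i, ¬ p i ∣ a) ∧ b ∣ (∏ i, p i) ^ k := by
  induction n using Nat.recOnMul with
  | zero => exact absurd rfl hn
  | one => exact ⟨1, 1, 0, rfl, fun i => (Fact.out : (p i).Prime).one_lt.ne' ∘ Nat.dvd_one.mp,
      one_dvd _⟩
  | prime q hq =>
    by_cases h : ∃ i, p i = q
    · obtain ⟨i, rfl⟩ := h
      exact ⟨1, p i, 1, (one_mul _).symm,
        fun i => (Fact.out : (p i).Prime).one_lt.ne' ∘ Nat.dvd_one.mp,
        by simpa using Finset.dvd_prod_of_mem p (Finset.mem_univ i)⟩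
    · exact ⟨q, 1, 0, (mul_one _).symm,
        fun i hi => h ⟨i, (Nat.prime_dvd_prime_iff_eq Fact.out hq).mp hi⟩, one_dvd _⟩
  | mul m m' h h' =>
    obtain ⟨a, b, k, e, ha, hb⟩ := h (left_ne_zero_of_mul hn)
    obtain ⟨a', b', k', e', ha', hb'⟩ := h' (right_ne_zero_of_mul hn)
    refine ⟨a * a', b * b', k + k', by rw [e, e']; ring, fun i hi => ?_, ?_⟩
    · exact ((Nat.Prime.dvd_mul Fact.out).mp hi).elim (ha i) (ha' i)
    · rw [pow_add]
      exact mul_dvd_mul hb hb'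

variable [IsTopologicalAddGroup G]

/-- The restriction of a homomorphism `∏ ℤ_{p_i} → G` to the factors on which it is injective is
injective, with image of finite index in the original image. -/
theorem exists_injective_restriction [CompactSpace G] [T2Space G] (hp : Function.Injective p)
    (f : (∀ i, ℤ_[p i]) →+ G) (hf : Continuous f) (hr : IsOpen (f.range : Set G)) :
    ∃ (P : ι → Prop) (s : (∀ i : Subtype P, ℤ_[p i]) →+ G), Continuous s ∧
      Function.Injective s ∧ IsOpen (s.range : Set G) := by
  classical
  let P : ι → Prop := fun i => ∀ x, f (Pi.single i x) = 0 → x = 0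
  let E : (∀ i : Subtype P, ℤ_[p i]) →+ (∀ i, ℤ_[p i]) :=
    { toFun := fun y i => if h : P i then y ⟨i, h⟩ else 0
      map_zero' := by ext i; simp
      map_add' := fun x y => by
        ext i
        by_cases h : P i <;> simp [h] }
  have hE : Continuous E := by
    refine continuous_pi fun i => ?_
    by_cases h : P i
    · simpa [E, h] using continuous_apply (⟨i, h⟩ : Subtype P)
    · simpa [E, h] using continuous_const
  have hbot : IsClosed ((⊥ : AddSubgroup G) : Set G) := by
    rw [AddSubgroup.coe_bot]
    exact isClosed_singleton
  have hzero : ∀ x, f x = 0 ↔ ∀ i, f (Pi.single i (x i)) = 0 := fun x => by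
    simpa using map_mem_iff_forall_single_mem hp f hf hbot (x := x)
  have hsE : Continuous (f.comp E) := hf.comp hE
  refine ⟨P, f.comp E, hsE, ?_, ?_⟩
  · rw [injective_iff_map_eq_zero]
    intro y hy
    ext1 i
    refine i.2 _ ?_
    have := (hzero _).mp hy i
    simpa [E, i.2] using this
  · have hm : ∀ i, ∃ m : ℕ, ¬ P i → f (Pi.single i ((p i : ℤ_[p i]) ^ m)) = 0 := by
      intro i
      by_cases hi : P i
      · exact ⟨0, fun h => absurd hi h⟩
      · obtain ⟨x, hx, hx0⟩ : ∃ x, f (Pi.single i x) = 0 ∧ x ≠ 0 := by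
          simpa [P] using hi
        obtain ⟨m, c, hc⟩ := PadicInt.exists_dvd_pow hx0
        refine ⟨m, fun _ => ?_⟩
        rw [hc, mul_comm]
        have := map_single_mul_mem hp f hf hbot c x (by simpa using hx)
        simpa using this
    choose m hm using hm
    -- A common exponent that annihilates every factor on which f is not injective. On the open
    -- subgroup of multiples of c, f agrees with its restriction to the injective factors, so the
    -- restricted image still has finite index.
    let c : ∀ i, ℤ_[p i] := fun i => (p i : ℤ_[p i]) ^ (∑ j, m j)
    have hc : ∀ i x, ¬ P i → f (Pi.single i (c i * x)) = 0 := by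
      intro i x hi
      have e : c i * x = (p i : ℤ_[p i]) ^ (∑ j ∈ Finset.univ.erase i, m j) * x *
          (p i : ℤ_[p i]) ^ m i := by
        simp only [c]
        rw [← Finset.sum_erase_add _ _ (Finset.mem_univ i), pow_add]
        ring
      rw [e]
      have := map_single_mul_mem hp f hf hbot
        ((p i : ℤ_[p i]) ^ (∑ j ∈ Finset.univ.erase i, m j) * x) _ (by simpa using hm i hi)
      simpa using this
    let V : AddSubgroup (∀ i, ℤ_[p i]) := (AddMonoidHom.mulLeft c).range
    have hV : IsOpen (V : Set (∀ i, ℤ_[p i])) := by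
      refine AddSubgroup.isOpen_of_mem_nhds (g := 0) V ?_
      filter_upwards [eventually_forall_pow_dvd (p := p) (∑ j, m j)] with x hx
      choose y hy using hx
      exact ⟨y, funext fun i => (hy i).symm⟩
    have : Finite ((∀ i, ℤ_[p i]) ⧸ V) := AddSubgroup.quotient_finite_of_isOpen V hV
    have hVfin : V.FiniteIndex := AddSubgroup.finiteIndex_of_finite_quotient
    have : Finite (G ⧸ f.range) := AddSubgroup.quotient_finite_of_isOpen _ hr
    have hrfin : f.range.FiniteIndex := AddSubgroup.finiteIndex_of_finite_quotient
    have hle : V.map f ≤ (f.comp E).range := by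
      rintro _ ⟨_, ⟨x, rfl⟩, rfl⟩
      refine ⟨fun i => c i * x i, ?_⟩
      rw [AddMonoidHom.comp_apply, ← sub_eq_zero, ← map_sub, hzero]
      intro i
      by_cases hi : P i
      · simp [E, hi]
      · have := hc i (-x i) hi
        simpa [E, hi] using this
    have hmap : (V.map f).FiniteIndex := ⟨by
      rw [AddSubgroup.index_map]
      exact mul_ne_zero (AddSubgroup.finiteIndex_of_le (le_sup_left : V ≤ V ⊔ f.ker)).index_ne_zero
        hrfin.index_ne_zero⟩
    have : (f.comp E).range.FiniteIndex := AddSubgroup.finiteIndex_of_le hle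
    refine AddSubgroup.isOpen_of_isClosed_of_finiteIndex _ ?_
    rw [AddMonoidHom.coe_range]
    exact (isCompact_range hsE).isClosed

/-- A profinite abelian group with an open subgroup isomorphic to a finite product of `ℤ_{p_i}`,
for distinct primes `p_i`, is itself such a product up to a finite factor. -/
theorem exists_finite_prod_equiv [CompactSpace G] [T2Space G] [TotallyDisconnectedSpace G]
    (hp : Function.Injective p) (s : (∀ i, ℤ_[p i]) →+ G) (hs : Continuous s)
    (hinj : Function.Injective s) (hr : IsOpen (s.range : Set G)) :
    ∃ A : AddSubgroup G, Finite A ∧ Nonempty ((A × ∀ i, ℤ_[p i]) ≃ₜ+ G) := by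
  classical
  have : Finite (G ⧸ s.range) := AddSubgroup.quotient_finite_of_isOpen _ hr
  have hrfin : s.range.FiniteIndex := AddSubgroup.finiteIndex_of_finite_quotient
  set n := s.range.index with hn
  have hn0 : n ≠ 0 := hrfin.index_ne_zero
  have hnmem : ∀ y : G, n • y ∈ s.range := fun y => AddSubgroup.nsmul_index_mem _ y
  have hn0' : ∀ i, (n : ℤ_[p i]) ≠ 0 := fun i => Nat.cast_ne_zero.mpr hn0
  -- The subgroup nG lies inside the range of s and corresponds there to the ideal generated by δ; a
  -- section of multiplication by n over nG splits G.
  let N : AddSubgroup G := (nsmulAddMonoidHom n : G →+ G).range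
  have hN : IsClosed (N : Set G) := by
    rw [AddMonoidHom.coe_range]
    exact (isCompact_range (continuous_nsmul n)).isClosed
  have hδ : ∀ i, ∃ δ : ℤ_[p i], δ ≠ 0 ∧ ∀ x, s (Pi.single i x) ∈ N ↔ δ ∣ x := by
    intro i
    let J : Ideal ℤ_[p i] :=
      { carrier := {x | s (Pi.single i x) ∈ N}
        zero_mem' := by simp
        add_mem' := fun {x y} hx hy => by
          have : s (Pi.single i x) + s (Pi.single i y) ∈ N := add_mem hx hy
          rwa [← map_add, ← Pi.single_add] at this
        smul_mem' := fun c x hx => map_single_mul_mem hp s hs hN c x hx }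
    obtain ⟨δ, hJ⟩ := (IsPrincipalIdealRing.principal J).principal
    have hmem : ∀ x, s (Pi.single i x) ∈ N ↔ δ ∣ x := fun x => by
      rw [← Ideal.mem_span_singleton]
      exact SetLike.ext_iff.mp hJ x
    refine ⟨δ, ?_, hmem⟩
    rintro rfl
    refine hn0' i (zero_dvd_iff.mp ((hmem _).mp ⟨s (Pi.single i 1), ?_⟩))
    rw [nsmulAddMonoidHom_apply, ← map_nsmul, ← Pi.single_smul, nsmul_one]
  choose δ hδ0 hδ using hδ
  have hsN : ∀ x, s x ∈ N ↔ ∀ i, δ i ∣ x i := fun x => by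
    rw [map_mem_iff_forall_single_mem hp s hs hN]
    exact forall_congr' fun i => hδ i _
  obtain ⟨g, hg⟩ := (hsN δ).mpr fun i => dvd_rfl
  replace hg : n • g = s δ := hg
  -- A preimage g of s(δ) under multiplication by n may carry torsion prime to all p_i, which
  -- obstructs extending n ↦ ng. Multiplying by the part a of n prime to all p_i removes it and
  -- costs nothing, as a is a unit in every ℤ_{p_i}.
  obtain ⟨a, b, k, hab, ha, hb⟩ := exists_mul_eq_dvd_prod_pow (p := p) n hn0
  have hunit : ∀ i, IsUnit (a : ℤ_[p i]) := fun i => by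
    rw [PadicInt.isUnit_iff, PadicInt.norm_natCast_eq_one_iff]
    exact (Nat.Prime.coprime_iff_not_dvd Fact.out).mpr (ha i)
  obtain ⟨t, ht, ht1⟩ := exists_continuous_addHom_map_one hp (a • g) (by
    intro U hU
    obtain ⟨c, hc⟩ := hb
    have h1 : Filter.Tendsto (fun l => s ((((∏ i, p i) ^ l : ℕ) : ∀ i, ℤ_[p i]) * (c • δ)))
        Filter.atTop (nhds 0) := by
      have := (hs.tendsto 0).comp (tendsto_prod_pow_mul (c • δ))
      rwa [map_zero] at this
    obtain ⟨l, hl⟩ := (h1.eventually (hU.mem_nhds U.zero_mem)).exists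
    refine ⟨l + k, ?_⟩
    have e : ((∏ i, p i) ^ (l + k)) • a • g =
        s ((((∏ i, p i) ^ l : ℕ) : ∀ i, ℤ_[p i]) * (c • δ)) := by
      rw [← nsmul_eq_mul, map_nsmul, map_nsmul, ← hg, hab, pow_add, hc]
      simp only [← mul_smul]
      congr 1
      ring
    rw [e]
    exact hl)
  have hnt : ∀ x, n • t x = s (a • δ * x) := by
    have h := addHom_eq_of_map_one_eq hp (f := (nsmulAddMonoidHom n).comp t)
      (f' := s.comp (AddMonoidHom.mulLeft (a • δ))) ((continuous_nsmul n).comp ht)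
      (hs.comp (continuous_const.mul continuous_id)) (by
        simp only [AddMonoidHom.comp_apply, nsmulAddMonoidHom_apply, AddMonoidHom.coe_mulLeft,
          mul_one, ht1, map_nsmul]
        rw [← hg, smul_comm])
    exact fun x => DFunLike.congr_fun h x
  -- The n-torsion is finite because the range of s is torsion-free of finite index. It complements
  -- the range of t, since n t(x) = s(aδx) already exhausts nG injectively.
  let A : AddSubgroup G := (nsmulAddMonoidHom n : G →+ G).ker
  have hA : ∀ y, y ∈ A ↔ n • y = 0 := fun y => Iff.rfl
  have hAfin : Finite A := by
    refine Finite.of_injective (fun y : A => (QuotientAddGroup.mk y.1 : G ⧸ s.range)) ?_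
    intro y z hyz
    obtain ⟨x, hx⟩ := QuotientAddGroup.eq.mp hyz
    have h1 : n • x = 0 := hinj (by
      rw [map_nsmul, map_zero, hx, smul_add, smul_neg, (hA _).mp y.2, (hA _).mp z.2]
      simp)
    have h2 : x = 0 := by
      ext1 i
      have := congr_fun h1 i
      rw [Pi.smul_apply, nsmul_eq_mul] at this
      exact (mul_eq_zero.mp this).resolve_left (hn0' i)
    rw [h2, map_zero] at hx
    exact Subtype.ext (neg_add_eq_zero.mp hx.symm)
  let Φ : (A × ∀ i, ℤ_[p i]) →+ G := AddMonoidHom.coprod A.subtype t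
  have hΦ : Continuous Φ :=
    (continuous_subtype_val.comp continuous_fst).add (ht.comp continuous_snd)
  have hΦinj : Function.Injective Φ := by
    rw [injective_iff_map_eq_zero]
    rintro ⟨α, x⟩ h
    replace h : (α : G) + t x = 0 := h
    have h1 : s (a • δ * x) = 0 := by
      rw [← hnt, eq_neg_of_add_eq_zero_right h, smul_neg, (hA _).mp α.2, neg_zero]
    have h2 : x = 0 := by
      have h3 : a • δ * x = 0 := hinj (by rw [h1, map_zero])
      ext1 i
      have := congr_fun h3 i
      rw [Pi.mul_apply, Pi.smul_apply, nsmul_eq_mul] at this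
      exact (mul_eq_zero.mp this).resolve_left (mul_ne_zero (hunit i).ne_zero (hδ0 i))
    subst h2
    rw [map_zero, add_zero] at h
    exact Prod.ext (Subtype.ext h) rfl
  have hΦsurj : Function.Surjective Φ := by
    intro y
    obtain ⟨z, hz⟩ := hnmem y
    have hd : ∀ i, ∃ x, z i = a • δ i * x := by
      intro i
      obtain ⟨w, hw⟩ := (hsN z).mp (by rw [hz]; exact ⟨y, rfl⟩) i
      obtain ⟨v, hv⟩ := (hunit i).dvd (a := w)
      exact ⟨v, by rw [hw, hv, nsmul_eq_mul]; ring⟩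
    choose x hx using hd
    have h1 : n • t x = n • y := by
      rw [hnt, ← hz]
      congr 1
      exact (funext hx).symm
    refine ⟨(⟨y - t x, ?_⟩, x), ?_⟩
    · rw [hA, smul_sub, h1, sub_self]
    · exact sub_add_cancel y (t x)
  let e : (A × ∀ i, ℤ_[p i]) ≃+ G := AddEquiv.ofBijective Φ ⟨hΦinj, hΦsurj⟩
  have he : Continuous e.toEquiv := hΦ
  exact ⟨A, hAfin, ⟨⟨e, he, (Continuous.homeoOfEquivCompactToT2 he).symm.continuous⟩⟩⟩

/-- The structure of profinite abelian groups with countably many closed subgroups. -/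
theorem exists_equiv_of_countable_closedAddSubgroup [CompactSpace G] [T2Space G]
    [TotallyDisconnectedSpace G] [Countable {H : AddSubgroup G // IsClosed (H : Set G)}] :
    ∃ (A : AddSubgroup G) (r : ℕ) (p : Fin r → ℕ) (_ : ∀ i, Fact (p i).Prime),
      Finite A ∧ Function.Injective p ∧ Nonempty ((A × ∀ i, ℤ_[p i]) ≃ₜ+ G) := by
  obtain ⟨g, hg⟩ := exists_isOpen_closure_zmultiples (G := G)
  have hfin := finite_supportPrimes g
  let ι := hfin.toFinset
  have hprime : ∀ i : ι, Fact (i : ℕ).Prime := fun i => ⟨(hfin.mem_toFinset.mp i.2).1⟩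
  have hinj : Function.Injective (fun i : ι => (i : ℕ)) := Subtype.val_injective
  obtain ⟨f, hf, hf1⟩ := exists_continuous_addHom_map_one hinj g (fun U hU => by
    obtain ⟨k, hk⟩ := exists_prod_pow_smul_mem g hfin.toFinset
      (fun q hq => hfin.mem_toFinset.mpr hq) U hU
    refine ⟨k, ?_⟩
    rwa [Finset.prod_coe_sort hfin.toFinset (fun i => i)])
  have hfr : IsOpen (f.range : Set G) := by
    refine AddSubgroup.isOpen_mono (AddSubgroup.topologicalClosure_minimal _ ?_ ?_) hg
    · rw [AddSubgroup.zmultiples_le]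
      exact ⟨1, hf1⟩
    · rw [AddMonoidHom.coe_range]
      exact (isCompact_range hf).isClosed
  obtain ⟨P, s, hs, hsinj, hsr⟩ := exists_injective_restriction hinj f hf hfr
  classical
  let e := Fintype.equivFin (Subtype P)
  let p : Fin (Fintype.card (Subtype P)) → ℕ := fun i => ((e.symm i).1 : ℕ)
  have hp : Function.Injective p :=
    Subtype.val_injective.comp (Subtype.val_injective.comp e.symm.injective)
  have hpp : ∀ i, Fact (p i).Prime := fun i => hprime (e.symm i).1
  let L := ContinuousLinearEquiv.piCongrLeft ℕ (fun i : Subtype P => ℤ_[(i.1 : ℕ)]) e.symm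
  let l : (∀ i, ℤ_[p i]) →+ (∀ i : Subtype P, ℤ_[(i.1 : ℕ)]) := L.toLinearMap.toAddMonoidHom
  have hl : Continuous l := L.continuous
  have hrange : (s.comp l).range = s.range :=
    SetLike.coe_injective (L.surjective.range_comp s)
  obtain ⟨A, hA, hE⟩ := exists_finite_prod_equiv hp (s.comp l) (hs.comp hl)
    (hsinj.comp L.injective) (by rwa [hrange])
  exact ⟨A, _, p, hpp, hA, hp, hE⟩

end PadicSplitting

/-! ### Transfer to multiplicative notation. -/

section ClosedSubgroupsOfCommGroup

variable {G : Type u} [CommGroup G] [TopologicalSpace G]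

theorem countable_closedSubgroupClasses_iff_of_comm :
    Countable (ClosedSubgroupClasses G) ↔ Countable (ClosedSubgroup G) := by
  refine ⟨fun _ => ?_, fun _ => inferInstance⟩
  refine Function.Injective.countable
    (f := fun H : ClosedSubgroup G => (Quotient.mk _ H : ClosedSubgroupClasses G)) ?_
  intro H K h
  obtain ⟨g, hg⟩ := Quotient.exact h
  refine ClosedSubgroup.toSubgroup_injective ?_
  rw [← hg]
  ext x
  simp

theorem countable_closedAddSubgroup_additive [Countable (ClosedSubgroup G)] :
    Countable {H : AddSubgroup (Additive G) // IsClosed (H : Set (Additive G))} := by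
  refine Function.Injective.countable (f := fun H =>
    (⟨AddSubgroup.toSubgroup' H.1, H.2⟩ : ClosedSubgroup G)) ?_
  intro H K h
  exact Subtype.ext (AddSubgroup.toSubgroup'.injective (congrArg ClosedSubgroup.toSubgroup h))

theorem IsFiniteTimesDistinctPadics.countable_closedSubgroup
    (h : IsFiniteTimesDistinctPadics G) : Countable (ClosedSubgroup G) := by
  obtain ⟨A, _, _, r, p, hpp, _, _, hp, ⟨φ⟩⟩ := h
  let ψ : (Additive A × ∀ i, ℤ_[p i]) →+ Additive G :=
    { toFun := fun z => Additive.ofMul (φ.symm (z.1.toMul, fun i => Multiplicative.ofAdd (z.2 i)))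
      map_zero' := map_one φ.symm
      map_add' := fun z w => map_mul φ.symm (z.1.toMul, fun i => Multiplicative.ofAdd (z.2 i))
        (w.1.toMul, fun i => Multiplicative.ofAdd (w.2 i)) }
  have hψ : Continuous ψ := φ.symm.continuous.comp
    (continuous_fst.prodMk (continuous_pi fun i => (continuous_apply i).comp continuous_snd))
  have hsurj : Function.Surjective ψ := fun g =>
    ⟨(Additive.ofMul (φ g.toMul).1, fun i => ((φ g.toMul).2 i).toAdd), φ.symm_apply_apply _⟩
  have hc := countable_closedAddSubgroup_prod (A := Additive A) hp
  let F : ClosedSubgroup G →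
      {H : AddSubgroup (Additive A × ∀ i, ℤ_[p i]) // IsClosed (H : Set (Additive A × ∀ i, ℤ_[p i]))} :=
    fun H => ⟨(Subgroup.toAddSubgroup H.toSubgroup).comap ψ, H.isClosed'.preimage hψ⟩
  refine Function.Injective.countable (f := F) ?_
  intro H K h
  have := AddSubgroup.comap_injective hsurj (congrArg Subtype.val h)
  exact ClosedSubgroup.toSubgroup_injective (Subgroup.toAddSubgroup.injective this)

theorem isFiniteTimesDistinctPadics_of_equiv {A : Type u} [AddCommGroup A] [TopologicalSpace A]
    [Finite A] [DiscreteTopology A] {r : ℕ} {p : Fin r → ℕ} [hpp : ∀ i, Fact (p i).Prime]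
    (hp : Function.Injective p) (E : (A × ∀ i, ℤ_[p i]) ≃ₜ+ Additive G) :
    IsFiniteTimesDistinctPadics G := by
  -- The finite factor lives in the universe of G, while `IsFiniteTimesDistinctPadics` asks for one
  -- in `Type`.
  let B : Type := Shrink.{0} A
  let _ : AddCommGroup B := inferInstanceAs (AddCommGroup (Shrink.{0} A))
  let e : B ≃+ A := Shrink.addEquiv
  let _ : TopologicalSpace B := ⊥
  have : DiscreteTopology B := ⟨rfl⟩
  have he : Continuous e := continuous_of_discreteTopology
  have he' : Continuous e.symm := continuous_of_discreteTopology
  have : Finite B := Finite.of_equiv A e.symm.toEquiv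
  refine ⟨Multiplicative B, inferInstance, inferInstance, r, p, hpp, inferInstance, inferInstance,
    hp, ⟨⟨⟨⟨?_, ?_, ?_, ?_⟩, ?_⟩, ?_, ?_⟩⟩⟩
  · exact fun g => (Multiplicative.ofAdd (e.symm (E.symm (Additive.ofMul g)).1),
      fun i => Multiplicative.ofAdd ((E.symm (Additive.ofMul g)).2 i))
  · exact fun z => (E (e z.1.toAdd, fun i => (z.2 i).toAdd)).toMul
  · intro g
    simp
  · intro z
    simp
  · intro g h
    simp [Prod.ext_iff, funext_iff]
  · have h : Continuous fun g : G => E.symm (Additive.ofMul g) := E.symm.continuous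
    exact (he'.comp (continuous_fst.comp h)).prodMk
      (continuous_pi fun i => (continuous_apply i).comp (continuous_snd.comp h))
  · exact E.continuous.comp ((he.comp continuous_fst).prodMk
      (continuous_pi fun i => (continuous_apply i).comp continuous_snd))

theorem countable_closedSubgroup_iff [IsTopologicalGroup G] [CompactSpace G] [T2Space G]
    [TotallyDisconnectedSpace G] :
    Countable (ClosedSubgroup G) ↔ IsFiniteTimesDistinctPadics G := by
  refine ⟨fun _ => ?_, IsFiniteTimesDistinctPadics.countable_closedSubgroup⟩
  have := countable_closedAddSubgroup_additive (G := G)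
  have : TotallyDisconnectedSpace (Additive G) := ‹TotallyDisconnectedSpace G›
  obtain ⟨A, r, p, hpp, hA, hp, ⟨E⟩⟩ := exists_equiv_of_countable_closedAddSubgroup (G := Additive G)
  exact isFiniteTimesDistinctPadics_of_equiv hp E

end ClosedSubgroupsOfCommGroup

theorem proposition13p9 :
    (∀ (G : Type u) [CommGroup G] [TopologicalSpace G] [IsTopologicalGroup G]
        [CompactSpace G] [T2Space G] [TotallyDisconnectedSpace G],
      (Countable (ClosedSubgroup G) ↔ IsFiniteTimesDistinctPadics G) ∧
      (Countable (ClosedSubgroupClasses G) ↔ IsFiniteTimesDistinctPadics G)) ∧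
    (∀ (p : ℕ) [Fact p.Prime] (n : ℕ),
      Countable (ClosedSubgroupClasses (Matrix.SpecialLinearGroup (Fin n) ℤ_[p])) ↔ n ≤ 2) :=
  ⟨fun _ => ⟨countable_closedSubgroup_iff,
    countable_closedSubgroupClasses_iff_of_comm.trans countable_closedSubgroup_iff⟩,
    fun p _ n => countable_closedSubgroupClasses_specialLinearGroup_iff p n⟩
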